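/- Let $n>2$. For $0\le k\le n-2$ let $T_k,G_k$ be the endofunctors (monotone self-maps) of the ordinal category $\mathbf n=\{0\to1\to\dots\to n-1\}$ with $T_k(k)=k+1$, $T_k(j)=j$ for $j\ne k$, and $G_k(k+1)=k$, $G_k(j)=j$ for $j\neq k+1$, and let $\eta_k:\mathrm{id}\Rightarrow T_k$, $\epsilon_k:G_k\Rightarrow\mathrm{id}$ be the unique natural transformations. A symmetric monoidal $n$-comprehension is a symmetric monoidal category $(\mathcal C,\otimes,\top,l,a,\sigma)$ with strict symmetric monoidal endofunctors $T_k,G_k$ and symmetric monoidal transformations $\eta_k:\mathrm{id}\Rightarrow T_k$, $\epsilon_k:G_k\Rightarrow \mathrm{id}$ that are the values of a strict bifunctor $\Im:M_n^{op}\to(\mathcal C,\mathcal C)$, where $M_n^{op}$ is the monoid of endofunctors of $\mathbf n$ with product $fg=g\circ f$ and with the natural transformations as 2-cells. It is a symmetric monoidal $n$-comprehension with recursion if moreover: (i) it contains a diagram $\top\xrightarrow{0_0}N_0\xrightarrow{s_0}N_0$ such that, with $N_{i+1}=G_iN_i$, $0_{i+1}=G_i0_i$, $s_{i+1}=G_is_i$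 for $0\le i\le n-2$, one has $T_0N_0=\top$, $T_iN_i=N_{i-1}$ for $i\ne0$, $T_iN_j=N_j$ and $G_iN_j=N_j$ for $i\neq j$, and $T_0(0_0)=T_0(s_0)=\mathrm{id}_\top$; (ii) (flat recursion) for all $X,Y$ of the form $N_0^{\otimes\alpha}$ and all $g:X\to Y$, $h:N_0\otimes X\to Y$ there is a unique $f:N_0\otimes X\to Y$ with $f\circ(0_0\otimes X)=g\circ l$ and $f\circ(s_0\otimes X)=h$; (iii) (safe ramified recursion) for $0\le k\le n-2$, all $X$, all $Y$ with $T_0T_1\cdots T_kY$ ($T_k$ applied first) isomorphic to $\top$, and all $g:X\to Y$, $h:Y\to Y$ there is a unique $f:N_{k+1}\otimes X\to Y$ with $f\circ(0_{k+1}\otimes X)=g\circ l$ and $f\circ(s_{k+1}\otimes X)=h\circ f$; (iv) (safe dependent recursion) for $0\le k\le n-2$, all tensor products $X,Y$ of the objects $N_0,\dots,N_{n-1}$ with $T_0T_1\cdots T_kY$ isomorphic to $\top$, and all $g:X\to Y$, $h:(N_{k+1}\otimes X)\otimes Y\to Y$ there is a unique $f:N_{k+1}\otimes X\to Y$ with $f\circ(0_{k+1}\otimes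 X)=g\circ l$ and $f\circ(s_{k+1}\otimes X)=h\circ\langle \mathrm{id},f\rangle$. Here $\langle t,u\rangle=(t\otimes u)\circ\delta$, where the diagonal $\delta$ of a tensor product of levels is built in the evident way from $\delta_\top=l^{-1}$, $\delta_{N_{k+1}}=G_k(d_k\circ r^{-1})$ and $\delta_{N_0}=T_1\delta_{N_1}$, where $r=l\circ\sigma:X\otimes\top\to X$ is the right unit and $d_k:N_{k+1}\otimes\top\to N_k\otimes N_k$ is defined by safe ramified recursion from $(0_k\otimes 0_k)\circ l^{-1}$ and $s_k\otimes s_k$. Let $\mathcal{FR}^n$ be the free symmetric monoidal $n$-comprehension with recursion: its objects are freely generated by $\top,N_0,\dots,N_{n-1}$ under $\otimes$, and its arrows are the formal arrows generated by the above structure modulo the equations above (including the uniqueness clauses). Let $\Gamma=\mathcal{FR}^n(\top,-):\mathcal{FR}^n\to\mathbf{Set}$ be the global sections functor. Then for every $k=0,1,\dots,n-1$, $$\Gamma N_k=\{\,std_k\,m\mid m\in\mathbf N\,\},$$ where $std_k:\mathbf N\to\Gamma N_k$ is defined by $std_k\,0=0_k$ and $std_k(m+1)=s_k\circ std_k\,m$.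 In other words, every arrow $\top\to N_k$ of $\mathcal{FR}^n$ equals $s_k^m\circ0_k$ for some $m\in\mathbf N$. -/

import Mathlib

open CategoryTheory MonoidalCategory Opposite

namespace FRn

/-! ### The category `n = {0 → 1 → ⋯ → n-1}` and its coercion functors

An endofunctor of the finite ordinal `n` is a monotone map `Fin n →o Fin n`, and since the category
is a poset there is a (unique) natural transformation `f ⟶ g` exactly when `f ≤ g`. -/

/-- The coercion functor `T_k` of the ordinal `n`: it sends `k` to `k + 1` and fixes the rest. -/
def coT {n : ℕ} (k : ℕ) (hk : k + 1 < n) : Fin n →o Fin n where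
  toFun j := if j.val = k then ⟨k + 1, hk⟩ else j
  monotone' := by
    intro a b hab
    have h : a.val ≤ b.val := hab
    by_cases h1 : a.val = k <;> by_cases h2 : b.val = k <;>
      simp only [h1, h2, if_true, if_false, le_refl, Fin.le_def] <;> omega

/-- The coercion functor `G_k` of the ordinal `n`: it sends `k + 1` to `k` and fixes the rest. -/
def coG {n : ℕ} (k : ℕ) (hk : k + 1 < n) : Fin n →o Fin n where
  toFun j := if j.val = k + 1 then ⟨k, by omega⟩ else j
  monotone' := by
    intro a b hab
    have h : a.val ≤ b.val := hab
    by_cases h1 : a.val = k + 1 <;> by_cases h2 : b.val = k + 1 <;>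
      simp only [h1, h2, if_true, if_false, le_refl, Fin.le_def] <;> omega

/-! ### Objects -/

/-- The objects freely generated by the unit `⊤`, the levels `N_0, …, N_{n-1}` and `⊗`. -/
inductive Obj (n : ℕ) : Type
  | top : Obj n
  | N : Fin n → Obj n
  | tensor : Obj n → Obj n → Obj n

/-- The action on objects of an endofunctor `f` of the ordinal `n`. It is strict monoidal, and on
levels it is the contravariant action `N_j ↦ N_j ∘ f`, where `N_j` is thought of as the chain with
entries `N` in positions `≤ j` and `⊤` in positions `> j`. For `T_i` and `G_i` this is the table
`T_0 N_0 = ⊤`, `T_i N_i = N_{i-1}` (`i ≠ 0`), `G_i N_i = N_{i+1}`, and `N_j ↦ N_j` for `i ≠ j`;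
see `act_coT_zero`, `act_coT_succ`, `act_coT_ne`, `act_coG_self`, `act_coG_ne` below. -/
def Obj.act {n : ℕ} (f : Fin n →o Fin n) : Obj n → Obj n
  | .top => .top
  | .N j =>
      if h : (Finset.univ.filter fun i => f i ≤ j).Nonempty then
        .N ((Finset.univ.filter fun i => f i ≤ j).max' h)
      else .top
  | .tensor X Y => .tensor (X.act f) (Y.act f)

/-- `T_0 (T_1 (⋯ (T_k Y)))`, the object on which the bounding condition is imposed. It is the
action on `Y` of the composite `T_k ∘ ⋯ ∘ T_0` of endofunctors of the ordinal, and it sends each of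
`N_0, …, N_k` to `⊤`. -/
def Obj.collapse {n : ℕ} : (k : ℕ) → k + 1 < n → Obj n → Obj n
  | 0, hk, Y => Y.act (coT 0 hk)
  | k + 1, hk, Y => (Y.act (coT (k + 1) hk)).collapse k (by omega)

/-- The objects of the form `N_0^α` (up to bracketing and unit factors). -/
inductive Obj.IsPowZero {n : ℕ} : Obj n → Prop
  | top : IsPowZero .top
  | N (h : 0 < n) : IsPowZero (.N ⟨0, h⟩)
  | tensor {X Y : Obj n} : IsPowZero X → IsPowZero Y → IsPowZero (.tensor X Y)

theorem act_N_eq {n : ℕ} (f : Fin n →o Fin n) (j m : Fin n)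
    (h : ∀ i, f i ≤ j ↔ i ≤ m) : (Obj.N j).act f = Obj.N m := by
  have hne : (Finset.univ.filter fun i => f i ≤ j).Nonempty :=
    ⟨m, by simp [h]⟩
  rw [Obj.act, dif_pos hne]
  congr 1
  apply le_antisymm
  · apply Finset.max'_le
    intro i hi
    exact (h i).1 (by simpa using hi)
  · apply Finset.le_max'
    simp [h]

theorem act_N_eq_top {n : ℕ} (f : Fin n →o Fin n) (j : Fin n)
    (h : ∀ i, ¬ f i ≤ j) : (Obj.N j).act f = Obj.top := by
  rw [Obj.act, dif_neg]
  rintro ⟨i, hi⟩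
  exact h i (by simpa using hi)

theorem act_N_exists {n : ℕ} (f : Fin n →o Fin n) (j : Fin n) :
    (∀ i, ¬ f i ≤ j) ∨ ∃ m, ∀ i, f i ≤ j ↔ i ≤ m := by
  by_cases h : (Finset.univ.filter fun i => f i ≤ j).Nonempty
  · refine Or.inr ⟨(Finset.univ.filter fun i => f i ≤ j).max' h, fun i => ⟨fun hi => ?_, fun hi => ?_⟩⟩
    · exact Finset.le_max' _ _ (by simpa using hi)
    · have hm := Finset.max'_mem _ h
      simp only [Finset.mem_filter, Finset.mem_univ, true_and] at hm
      exact (f.monotone hi).trans hm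
  · refine Or.inl fun i hi => h ⟨i, by simpa using hi⟩

/-- The identity of the ordinal acts as the identity. -/
theorem Obj.act_id {n : ℕ} (X : Obj n) : X.act OrderHom.id = X := by
  induction X with
  | top => rfl
  | N j => exact act_N_eq _ _ _ fun i => Iff.rfl
  | tensor X Y hX hY => simp only [Obj.act, hX, hY]

/-- The action reverses composition. -/
theorem Obj.act_act {n : ℕ} (f g : Fin n →o Fin n) (X : Obj n) :
    (X.act g).act f = X.act (g.comp f) := by
  induction X with
  | top => rfl
  | N j =>
    rcases act_N_exists g j with h | ⟨m, hm⟩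
    · rw [act_N_eq_top g j h, act_N_eq_top (g.comp f) j fun i => h (f i)]
      rfl
    · rw [act_N_eq g j m hm]
      rcases act_N_exists f m with h | ⟨l, hl⟩
      · rw [act_N_eq_top f m h, act_N_eq_top (g.comp f) j fun i => fun hi => h i ((hm _).1 hi)]
      · rw [act_N_eq f m l hl, act_N_eq (g.comp f) j l fun i => (hm (f i)).trans (hl i)]
  | tensor X Y hX hY => simp only [Obj.act, hX, hY]

theorem coT_val {n : ℕ} (k : ℕ) (hk : k + 1 < n) (j : Fin n) :
    (coT k hk j).val = if j.val = k then k + 1 else j.val := by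
  change (if j.val = k then (⟨k + 1, hk⟩ : Fin n) else j).val = _
  split_ifs <;> rfl

theorem coG_val {n : ℕ} (k : ℕ) (hk : k + 1 < n) (j : Fin n) :
    (coG k hk j).val = if j.val = k + 1 then k else j.val := by
  change (if j.val = k + 1 then (⟨k, _⟩ : Fin n) else j).val = _
  split_ifs <;> rfl

theorem act_coT_zero {n : ℕ} (h : 0 + 1 < n) :
    (Obj.N ⟨0, by omega⟩).act (coT 0 h) = (Obj.top : Obj n) := by
  apply act_N_eq_top
  intro x
  rw [Fin.le_def, coT_val]
  try dsimp only
  split_ifs <;> omega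

theorem act_coT_succ {n : ℕ} (i : ℕ) (h : i + 1 + 1 < n) :
    (Obj.N ⟨i + 1, by omega⟩).act (coT (i + 1) h) = (Obj.N ⟨i, by omega⟩ : Obj n) := by
  apply act_N_eq
  intro x
  rw [Fin.le_def, Fin.le_def, coT_val]
  try dsimp only
  split_ifs <;> omega

theorem act_coT_ne {n : ℕ} (i : ℕ) (h : i + 1 < n) (j : Fin n) (hj : j.val ≠ i) :
    (Obj.N j).act (coT i h) = Obj.N j := by
  apply act_N_eq
  intro x
  rw [Fin.le_def, Fin.le_def, coT_val]
  try dsimp only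
  split_ifs <;> omega

theorem act_coG_self {n : ℕ} (i : ℕ) (h : i + 1 < n) :
    (Obj.N ⟨i, by omega⟩).act (coG i h) = (Obj.N ⟨i + 1, h⟩ : Obj n) := by
  apply act_N_eq
  intro x
  rw [Fin.le_def, Fin.le_def, coG_val]
  try dsimp only
  split_ifs <;> omega

theorem act_coG_ne {n : ℕ} (i : ℕ) (h : i + 1 < n) (j : Fin n) (hj : j.val ≠ i) :
    (Obj.N j).act (coG i h) = Obj.N j := by
  apply act_N_eq
  intro x
  rw [Fin.le_def, Fin.le_def, coG_val]
  try dsimp only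
  split_ifs <;> omega

/-! ### Formal morphisms -/

/-- Raw terms for morphisms. `comp t u` is composition in diagrammatic order (`t` first),
`act f t` is the value at `t` of the endofunctor attached to `f` (so `T_k t = act (coT k _) t`),
and `cell f g X` is the component at `X` of the transformation attached to `f ≤ g` (so `η_k` and
`ε_k` are `cell id T_k` and `cell G_k id`). Typing is imposed by `Eqv`. -/
inductive Raw (n : ℕ) : Type
  | id : Obj n → Raw n
  | comp : Raw n → Raw n → Raw n
  | tens : Raw n → Raw n → Raw n
  | assoc : Obj n → Obj n → Obj n → Raw n
  | assocInv : Obj n → Obj n → Obj n → Raw n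
  | lam : Obj n → Raw n
  | lamInv : Obj n → Raw n
  | swap : Obj n → Obj n → Raw n
  | act : (Fin n →o Fin n) → Raw n → Raw n
  | cell : (Fin n →o Fin n) → (Fin n →o Fin n) → Obj n → Raw n
  | zero : Raw n
  | succ : Raw n
  | fr : Raw n → Raw n → Raw n
  | srr : ℕ → Raw n → Raw n → Raw n
  | sdr : ℕ → Raw n → Raw n → Raw n

namespace Raw

variable {n : ℕ}

/-- The right unit `X ⊗ ⊤ → X`, defined from the symmetry and the left unit. -/
def rho (X : Obj n) : Raw n := comp (swap X .top) (lam X)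

/-- The inverse of the right unit. -/
def rhoInv (X : Obj n) : Raw n := comp (lamInv X) (swap .top X)

/-- The numeral zero `0_j : ⊤ → N_j`, with `0_{j+1} = G_j 0_j`. -/
def zeroAt : (j : ℕ) → j < n → Raw n
  | 0, _ => zero
  | j + 1, h => act (coG j h) (zeroAt j (by omega))

/-- The successor `s_j : N_j → N_j`, with `s_{j+1} = G_j s_j`. -/
def succAt : (j : ℕ) → j < n → Raw n
  | 0, _ => succ
  | j + 1, h => act (coG j h) (succAt j (by omega))

/-- The interchange `(W ⊗ X) ⊗ (Y ⊗ Z) → (W ⊗ Y) ⊗ (X ⊗ Z)`. -/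
def mid (W X Y Z : Obj n) : Raw n :=
  comp (assoc W X (.tensor Y Z))
    (comp (tens (id W)
        (comp (assocInv X Y Z) (comp (tens (swap X Y) (id Z)) (assoc Y X Z))))
      (assocInv W Y (.tensor X Z)))

/-- The diagonal of `N_{k+1}`: it is `G_k (d ∘ r⁻¹)`, where `d : N_{k+1} ⊗ ⊤ → N_k ⊗ N_k` is
given by safe ramified recursion from `0_k ⊗ 0_k` and `s_k ⊗ s_k`. -/
def diagSucc (k : ℕ) (hk : k + 1 < n) : Raw n :=
  act (coG k hk)
    (comp (rhoInv (.N ⟨k + 1, hk⟩))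
      (srr k (comp (lamInv .top) (tens (zeroAt k (by omega)) (zeroAt k (by omega))))
        (tens (succAt k (by omega)) (succAt k (by omega)))))

/-- The diagonal `δ_X : X → X ⊗ X`. For `N_0` it is obtained by lowering that of `N_1` by `T_1`,
which is available because `n > 2`. -/
def diag (hn : 2 < n) : Obj n → Raw n
  | .top => lamInv .top
  | .N ⟨0, _⟩ => act (coT 1 hn) (diagSucc 0 (by omega))
  | .N ⟨k + 1, hk⟩ => diagSucc k hk
  | .tensor X Y => comp (tens (diag hn X) (diag hn Y)) (mid X X Y Y)

/-- The pairing `⟨t, u⟩ = (t ⊗ u) ∘ δ_X` of two morphisms with domain `X`. -/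
def pair (hn : 2 < n) (X : Obj n) (t u : Raw n) : Raw n := comp (diag hn X) (tens t u)

end Raw

open Raw in
/-- `Eqv hn X Y t u` means that `t` and `u` are well-formed terms `X → Y` which are equal in the
free symmetric monoidal `n`-comprehension with recursion; `Eqv hn X Y t t` says that `t : X → Y`
is well-formed. It is the least such relation closed under the axioms. -/
inductive Eqv {n : ℕ} (hn : 2 < n) : Obj n → Obj n → Raw n → Raw n → Prop
  -- equality
  | symm {X Y t u} : Eqv hn X Y t u → Eqv hn X Y u t
  | trans {X Y t u v} : Eqv hn X Y t u → Eqv hn X Y u v → Eqv hn X Y t v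
  -- category
  | id (X) : Eqv hn X X (id X) (id X)
  | comp {X Y Z t t' u u'} : Eqv hn X Y t t' → Eqv hn Y Z u u' →
      Eqv hn X Z (comp t u) (comp t' u')
  | id_comp {X Y t} : Eqv hn X Y t t → Eqv hn X Y (comp (id X) t) t
  | comp_id {X Y t} : Eqv hn X Y t t → Eqv hn X Y (comp t (id Y)) t
  | comp_assoc {W X Y Z t u v} : Eqv hn W X t t → Eqv hn X Y u u → Eqv hn Y Z v v →
      Eqv hn W Z (comp (comp t u) v) (comp t (comp u v))
  -- symmetric monoidal structure
  | tens {X X' Y Y' t t' u u'} : Eqv hn X Y t t' → Eqv hn X' Y' u u' →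
      Eqv hn (.tensor X X') (.tensor Y Y') (tens t u) (tens t' u')
  | tens_id (X Y) : Eqv hn (.tensor X Y) (.tensor X Y) (tens (id X) (id Y)) (id (.tensor X Y))
  | tens_comp {X Y Z X' Y' Z' t u t' u'} : Eqv hn X Y t t → Eqv hn Y Z u u →
      Eqv hn X' Y' t' t' → Eqv hn Y' Z' u' u' →
      Eqv hn (.tensor X X') (.tensor Z Z')
        (comp (tens t t') (tens u u')) (tens (comp t u) (comp t' u'))
  | assoc (X Y Z) : Eqv hn (.tensor (.tensor X Y) Z) (.tensor X (.tensor Y Z))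
      (assoc X Y Z) (assoc X Y Z)
  | assocInv (X Y Z) : Eqv hn (.tensor X (.tensor Y Z)) (.tensor (.tensor X Y) Z)
      (assocInv X Y Z) (assocInv X Y Z)
  | assoc_assocInv (X Y Z) : Eqv hn (.tensor (.tensor X Y) Z) (.tensor (.tensor X Y) Z)
      (comp (Raw.assoc X Y Z) (Raw.assocInv X Y Z)) (Raw.id (.tensor (.tensor X Y) Z))
  | assocInv_assoc (X Y Z) : Eqv hn (.tensor X (.tensor Y Z)) (.tensor X (.tensor Y Z))
      (comp (Raw.assocInv X Y Z) (Raw.assoc X Y Z)) (Raw.id (.tensor X (.tensor Y Z)))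
  | assoc_natural {X Y Z X' Y' Z' t u v} :
      Eqv hn X X' t t → Eqv hn Y Y' u u → Eqv hn Z Z' v v →
      Eqv hn (.tensor (.tensor X Y) Z) (.tensor X' (.tensor Y' Z'))
        (comp (tens (tens t u) v) (Raw.assoc X' Y' Z'))
        (comp (Raw.assoc X Y Z) (tens t (tens u v)))
  | lam (X) : Eqv hn (.tensor .top X) X (lam X) (lam X)
  | lamInv (X) : Eqv hn X (.tensor .top X) (lamInv X) (lamInv X)
  | lam_lamInv (X) : Eqv hn (.tensor .top X) (.tensor .top X)
      (comp (Raw.lam X) (Raw.lamInv X)) (Raw.id (.tensor .top X))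
  | lamInv_lam (X) : Eqv hn X X (comp (Raw.lamInv X) (Raw.lam X)) (Raw.id X)
  | lam_natural {X Y t} : Eqv hn X Y t t →
      Eqv hn (.tensor .top X) Y (comp (tens (Raw.id .top) t) (Raw.lam Y)) (comp (Raw.lam X) t)
  | swap (X Y) : Eqv hn (.tensor X Y) (.tensor Y X) (swap X Y) (swap X Y)
  | swap_swap (X Y) : Eqv hn (.tensor X Y) (.tensor X Y)
      (comp (Raw.swap X Y) (Raw.swap Y X)) (Raw.id (.tensor X Y))
  | swap_natural {X Y X' Y' t u} : Eqv hn X X' t t → Eqv hn Y Y' u u →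
      Eqv hn (.tensor X Y) (.tensor Y' X')
        (comp (tens t u) (Raw.swap X' Y')) (comp (Raw.swap X Y) (tens u t))
  | pentagon (W X Y Z) :
      Eqv hn (.tensor (.tensor (.tensor W X) Y) Z) (.tensor W (.tensor X (.tensor Y Z)))
        (comp (tens (Raw.assoc W X Y) (Raw.id Z))
          (comp (Raw.assoc W (.tensor X Y) Z) (tens (Raw.id W) (Raw.assoc X Y Z))))
        (comp (Raw.assoc (.tensor W X) Y Z) (Raw.assoc W X (.tensor Y Z)))
  | triangle (X Y) : Eqv hn (.tensor (.tensor X .top) Y) (.tensor X Y)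
      (comp (Raw.assoc X .top Y) (tens (Raw.id X) (Raw.lam Y))) (tens (rho X) (Raw.id Y))
  | hexagon (X Y Z) : Eqv hn (.tensor (.tensor X Y) Z) (.tensor Y (.tensor Z X))
      (comp (Raw.assoc X Y Z) (comp (Raw.swap X (.tensor Y Z)) (Raw.assoc Y Z X)))
      (comp (tens (Raw.swap X Y) (Raw.id Z))
        (comp (Raw.assoc Y X Z) (tens (Raw.id Y) (Raw.swap X Z))))
  -- the strict symmetric monoidal endofunctors attached to the endofunctors of the ordinal
  | act (f) {X Y t t'} : Eqv hn X Y t t' → Eqv hn (X.act f) (Y.act f) (act f t) (act f t')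
  | act_id (f X) : Eqv hn (X.act f) (X.act f) (Raw.act f (Raw.id X)) (Raw.id (X.act f))
  | act_comp (f) {X Y Z t u} : Eqv hn X Y t t → Eqv hn Y Z u u →
      Eqv hn (X.act f) (Z.act f)
        (Raw.act f (Raw.comp t u)) (Raw.comp (Raw.act f t) (Raw.act f u))
  | act_tens (f) {X Y X' Y' t u} : Eqv hn X Y t t → Eqv hn X' Y' u u →
      Eqv hn ((Obj.tensor X X').act f) ((Obj.tensor Y Y').act f)
        (Raw.act f (Raw.tens t u)) (Raw.tens (Raw.act f t) (Raw.act f u))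
  | act_assoc (f X Y Z) :
      Eqv hn ((Obj.tensor (.tensor X Y) Z).act f) ((Obj.tensor X (.tensor Y Z)).act f)
        (Raw.act f (Raw.assoc X Y Z)) (Raw.assoc (X.act f) (Y.act f) (Z.act f))
  | act_lam (f X) : Eqv hn ((Obj.tensor .top X).act f) (X.act f)
      (Raw.act f (Raw.lam X)) (Raw.lam (X.act f))
  | act_swap (f X Y) : Eqv hn ((Obj.tensor X Y).act f) ((Obj.tensor Y X).act f)
      (Raw.act f (Raw.swap X Y)) (Raw.swap (X.act f) (Y.act f))
  -- the symmetric monoidal transformations attached to the inequalities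
  | cell {f g} (h : f ≤ g) (X) : Eqv hn (X.act f) (X.act g) (cell f g X) (cell f g X)
  | cell_natural {f g} (h : f ≤ g) {X Y t} : Eqv hn X Y t t →
      Eqv hn (X.act f) (Y.act g)
        (Raw.comp (Raw.cell f g X) (Raw.act g t)) (Raw.comp (Raw.act f t) (Raw.cell f g Y))
  | cell_top {f g} (h : f ≤ g) :
      Eqv hn (Obj.top.act f) (Obj.top.act g) (Raw.cell f g .top) (Raw.id .top)
  | cell_tensor {f g} (h : f ≤ g) (X Y) :
      Eqv hn ((Obj.tensor X Y).act f) ((Obj.tensor X Y).act g)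
        (Raw.cell f g (.tensor X Y)) (Raw.tens (Raw.cell f g X) (Raw.cell f g Y))
  -- bifunctoriality: composites of 1-cells (in reversed order), composites of 2-cells, whiskering
  | act_one {X Y t} : Eqv hn X Y t t → Eqv hn X Y (Raw.act OrderHom.id t) t
  | act_act (f g) {X Y t} : Eqv hn X Y t t →
      Eqv hn ((X.act g).act f) ((Y.act g).act f)
        (Raw.act f (Raw.act g t)) (Raw.act (g.comp f) t)
  | cell_refl (f X) : Eqv hn (X.act f) (X.act f) (Raw.cell f f X) (Raw.id (X.act f))
  | cell_trans {f g h} (hfg : f ≤ g) (hgh : g ≤ h) (X) : Eqv hn (X.act f) (X.act h)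
      (Raw.comp (Raw.cell f g X) (Raw.cell g h X)) (Raw.cell f h X)
  | act_cell (e) {f g} (h : f ≤ g) (X) : Eqv hn ((X.act f).act e) ((X.act g).act e)
      (Raw.act e (Raw.cell f g X)) (Raw.cell (f.comp e) (g.comp e) X)
  | cell_act {f g} (h : f ≤ g) (e) (X) : Eqv hn ((X.act e).act f) ((X.act e).act g)
      (Raw.cell f g (X.act e)) (Raw.cell (e.comp f) (e.comp g) X)
  -- the initial diagram `⊤ → N_0 → N_0`, sent by `T_0` to identities
  | zero : Eqv hn .top (.N ⟨0, by omega⟩) zero zero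
  | succ : Eqv hn (.N ⟨0, by omega⟩) (.N ⟨0, by omega⟩) succ succ
  | coT_zero : Eqv hn .top .top (Raw.act (coT 0 (by omega)) Raw.zero) (Raw.id .top)
  | coT_succ : Eqv hn .top .top (Raw.act (coT 0 (by omega)) Raw.succ) (Raw.id .top)
  -- flat recursion: existence (with its two equations) and uniqueness
  | fr {X Y g g' h h'} : X.IsPowZero → Y.IsPowZero → Eqv hn X Y g g' →
      Eqv hn (.tensor (.N ⟨0, by omega⟩) X) Y h h' →
      Eqv hn (.tensor (.N ⟨0, by omega⟩) X) Y (fr g h) (fr g' h')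
  | fr_zero {X Y g h} : X.IsPowZero → Y.IsPowZero → Eqv hn X Y g g →
      Eqv hn (.tensor (.N ⟨0, by omega⟩) X) Y h h →
      Eqv hn (.tensor .top X) Y
        (Raw.comp (Raw.tens Raw.zero (Raw.id X)) (Raw.fr g h)) (Raw.comp (Raw.lam X) g)
  | fr_succ {X Y g h} : X.IsPowZero → Y.IsPowZero → Eqv hn X Y g g →
      Eqv hn (.tensor (.N ⟨0, by omega⟩) X) Y h h →
      Eqv hn (.tensor (.N ⟨0, by omega⟩) X) Y
        (Raw.comp (Raw.tens Raw.succ (Raw.id X)) (Raw.fr g h)) h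
  | fr_unique {X Y g h f} : X.IsPowZero → Y.IsPowZero → Eqv hn X Y g g →
      Eqv hn (.tensor (.N ⟨0, by omega⟩) X) Y h h →
      Eqv hn (.tensor (.N ⟨0, by omega⟩) X) Y f f →
      Eqv hn (.tensor .top X) Y
        (Raw.comp (Raw.tens Raw.zero (Raw.id X)) f) (Raw.comp (Raw.lam X) g) →
      Eqv hn (.tensor (.N ⟨0, by omega⟩) X) Y (Raw.comp (Raw.tens Raw.succ (Raw.id X)) f) h →
      Eqv hn (.tensor (.N ⟨0, by omega⟩) X) Y f (Raw.fr g h)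
  -- safe ramified recursion on level `k`, for `Y` such that `T_0 ⋯ T_k Y` is isomorphic to `⊤`
  -- (`i` and `j` are inverse isomorphisms)
  | srr {k} (hk : k + 1 < n) {X Y g g' h h' i j} :
      Eqv hn (Y.collapse k hk) .top i i → Eqv hn .top (Y.collapse k hk) j j →
      Eqv hn (Y.collapse k hk) (Y.collapse k hk) (Raw.comp i j) (Raw.id (Y.collapse k hk)) →
      Eqv hn .top .top (Raw.comp j i) (Raw.id .top) →
      Eqv hn X Y g g' → Eqv hn Y Y h h' →
      Eqv hn (.tensor (.N ⟨k + 1, hk⟩) X) Y (srr k g h) (srr k g' h')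
  | srr_zero {k} (hk : k + 1 < n) {X Y g h} :
      Eqv hn X Y g g → Eqv hn Y Y h h →
      Eqv hn (.tensor (.N ⟨k + 1, hk⟩) X) Y (Raw.srr k g h) (Raw.srr k g h) →
      Eqv hn (.tensor .top X) Y
        (Raw.comp (Raw.tens (zeroAt (k + 1) hk) (Raw.id X)) (Raw.srr k g h))
        (Raw.comp (Raw.lam X) g)
  | srr_succ {k} (hk : k + 1 < n) {X Y g h} :
      Eqv hn X Y g g → Eqv hn Y Y h h →
      Eqv hn (.tensor (.N ⟨k + 1, hk⟩) X) Y (Raw.srr k g h) (Raw.srr k g h) →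
      Eqv hn (.tensor (.N ⟨k + 1, hk⟩) X) Y
        (Raw.comp (Raw.tens (succAt (k + 1) hk) (Raw.id X)) (Raw.srr k g h))
        (Raw.comp (Raw.srr k g h) h)
  | srr_unique {k} (hk : k + 1 < n) {X Y g h f} :
      Eqv hn X Y g g → Eqv hn Y Y h h →
      Eqv hn (.tensor (.N ⟨k + 1, hk⟩) X) Y (Raw.srr k g h) (Raw.srr k g h) →
      Eqv hn (.tensor (.N ⟨k + 1, hk⟩) X) Y f f →
      Eqv hn (.tensor .top X) Y
        (Raw.comp (Raw.tens (zeroAt (k + 1) hk) (Raw.id X)) f) (Raw.comp (Raw.lam X) g) →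
      Eqv hn (.tensor (.N ⟨k + 1, hk⟩) X) Y
        (Raw.comp (Raw.tens (succAt (k + 1) hk) (Raw.id X)) f) (Raw.comp f h) →
      Eqv hn (.tensor (.N ⟨k + 1, hk⟩) X) Y f (Raw.srr k g h)
  -- safe dependent recursion on level `k`, with the same condition on `Y`; here every object is
  -- cartesian, being a tensor product of levels
  | sdr {k} (hk : k + 1 < n) {X Y g g' h h' i j} :
      Eqv hn (Y.collapse k hk) .top i i → Eqv hn .top (Y.collapse k hk) j j →
      Eqv hn (Y.collapse k hk) (Y.collapse k hk) (Raw.comp i j) (Raw.id (Y.collapse k hk)) →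
      Eqv hn .top .top (Raw.comp j i) (Raw.id .top) →
      Eqv hn X Y g g' → Eqv hn (.tensor (.tensor (.N ⟨k + 1, hk⟩) X) Y) Y h h' →
      Eqv hn (.tensor (.N ⟨k + 1, hk⟩) X) Y (sdr k g h) (sdr k g' h')
  | sdr_zero {k} (hk : k + 1 < n) {X Y g h} :
      Eqv hn X Y g g → Eqv hn (.tensor (.tensor (.N ⟨k + 1, hk⟩) X) Y) Y h h →
      Eqv hn (.tensor (.N ⟨k + 1, hk⟩) X) Y (Raw.sdr k g h) (Raw.sdr k g h) →
      Eqv hn (.tensor .top X) Y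
        (Raw.comp (Raw.tens (zeroAt (k + 1) hk) (Raw.id X)) (Raw.sdr k g h))
        (Raw.comp (Raw.lam X) g)
  | sdr_succ {k} (hk : k + 1 < n) {X Y g h} :
      Eqv hn X Y g g → Eqv hn (.tensor (.tensor (.N ⟨k + 1, hk⟩) X) Y) Y h h →
      Eqv hn (.tensor (.N ⟨k + 1, hk⟩) X) Y (Raw.sdr k g h) (Raw.sdr k g h) →
      Eqv hn (.tensor (.N ⟨k + 1, hk⟩) X) Y
        (Raw.comp (Raw.tens (succAt (k + 1) hk) (Raw.id X)) (Raw.sdr k g h))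
        (Raw.comp (pair hn (.tensor (.N ⟨k + 1, hk⟩) X)
          (Raw.id (.tensor (.N ⟨k + 1, hk⟩) X)) (Raw.sdr k g h)) h)
  | sdr_unique {k} (hk : k + 1 < n) {X Y g h f} :
      Eqv hn X Y g g → Eqv hn (.tensor (.tensor (.N ⟨k + 1, hk⟩) X) Y) Y h h →
      Eqv hn (.tensor (.N ⟨k + 1, hk⟩) X) Y (Raw.sdr k g h) (Raw.sdr k g h) →
      Eqv hn (.tensor (.N ⟨k + 1, hk⟩) X) Y f f →
      Eqv hn (.tensor .top X) Y
        (Raw.comp (Raw.tens (zeroAt (k + 1) hk) (Raw.id X)) f) (Raw.comp (Raw.lam X) g) →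
      Eqv hn (.tensor (.N ⟨k + 1, hk⟩) X) Y
        (Raw.comp (Raw.tens (succAt (k + 1) hk) (Raw.id X)) f)
        (Raw.comp (pair hn (.tensor (.N ⟨k + 1, hk⟩) X)
          (Raw.id (.tensor (.N ⟨k + 1, hk⟩) X)) f) h) →
      Eqv hn (.tensor (.N ⟨k + 1, hk⟩) X) Y f (Raw.sdr k g h)

/-! ### The free symmetric monoidal `n`-comprehension with recursion -/

theorem Eqv.left {n : ℕ} {hn : 2 < n} {X Y : Obj n} {t u : Raw n} (h : Eqv hn X Y t u) :
    Eqv hn X Y t t := h.trans h.symm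

/-- The well-formed terms `X → Y`, identified when they are provably equal. -/
def homSetoid {n : ℕ} (hn : 2 < n) (X Y : Obj n) : Setoid {t : Raw n // Eqv hn X Y t t} where
  r t u := Eqv hn X Y t.1 u.1
  iseqv := ⟨fun t => t.2, fun h => h.symm, fun h h' => h.trans h'⟩

/-- `Hom hn X Y` is the set of formal morphisms `X → Y`. -/
def Hom {n : ℕ} (hn : 2 < n) (X Y : Obj n) : Type := Quotient (homSetoid hn X Y)

/-- The class of a well-formed term. -/
def Hom.mk {n : ℕ} {hn : 2 < n} {X Y : Obj n} (t : Raw n) (h : Eqv hn X Y t t) : Hom hn X Y :=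
  Quotient.mk (homSetoid hn X Y) ⟨t, h⟩

theorem Hom.sound {n : ℕ} {hn : 2 < n} {X Y : Obj n} {t u : Raw n} (h : Eqv hn X Y t u)
    (ht : Eqv hn X Y t t) (hu : Eqv hn X Y u u) : Hom.mk t ht = Hom.mk u hu :=
  Quotient.sound (s := homSetoid hn X Y) h

theorem Hom.ind {n : ℕ} {hn : 2 < n} {X Y : Obj n} {P : Hom hn X Y → Prop}
    (h : ∀ t ht, P (Hom.mk t ht)) (f : Hom hn X Y) : P f :=
  Quotient.ind (s := homSetoid hn X Y) (fun t => h t.1 t.2) f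

/-- Composition of formal morphisms, in diagrammatic order. -/
def Hom.comp {n : ℕ} {hn : 2 < n} {X Y Z : Obj n} (f : Hom hn X Y) (g : Hom hn Y Z) :
    Hom hn X Z :=
  Quotient.map₂ (sa := homSetoid hn X Y) (sb := homSetoid hn Y Z) (sc := homSetoid hn X Z)
    (fun t u => ⟨Raw.comp t.1 u.1, Eqv.comp t.2 u.2⟩) (fun _ _ h _ _ h' => Eqv.comp h h') f g

/-- Tensor product of formal morphisms. -/
def Hom.tens {n : ℕ} {hn : 2 < n} {X Y X' Y' : Obj n} (f : Hom hn X Y) (g : Hom hn X' Y') :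
    Hom hn (.tensor X X') (.tensor Y Y') :=
  Quotient.map₂ (sa := homSetoid hn X Y) (sb := homSetoid hn X' Y')
    (sc := homSetoid hn (.tensor X X') (.tensor Y Y'))
    (fun t u => ⟨Raw.tens t.1 u.1, Eqv.tens t.2 u.2⟩) (fun _ _ h _ _ h' => Eqv.tens h h') f g

/-- The free symmetric monoidal `n`-comprehension with recursion `FR^n` (for `n > 2`). -/
def FR (n : ℕ) (_ : 2 < n) : Type := Obj n

/-- The unit object `⊤` of `FR^n`. -/
def FR.top {n : ℕ} {hn : 2 < n} : FR n hn := Obj.top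

/-- The tensor product on objects of `FR^n`. -/
def FR.tensor {n : ℕ} {hn : 2 < n} (X Y : FR n hn) : FR n hn := Obj.tensor X Y

instance {n : ℕ} (hn : 2 < n) : Category (FR n hn) where
  Hom X Y := Hom hn X Y
  id X := Hom.mk (Raw.id X) (Eqv.id X)
  comp f g := Hom.comp f g
  id_comp f := by
    induction f using Hom.ind with | _ t ht
    exact Hom.sound (Eqv.id_comp ht) _ _
  comp_id f := by
    induction f using Hom.ind with | _ t ht
    exact Hom.sound (Eqv.comp_id ht) _ _
  assoc f g h := by
    induction f using Hom.ind with | _ t ht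
    induction g using Hom.ind with | _ u hu
    induction h using Hom.ind with | _ v hv
    exact Hom.sound (Eqv.comp_assoc ht hu hv) _ _

theorem eqv_rho {n : ℕ} (hn : 2 < n) (X : Obj n) :
    Eqv hn (.tensor X .top) X (Raw.rho X) (Raw.rho X) :=
  Eqv.comp (Eqv.swap _ _) (Eqv.lam _)

theorem eqv_rhoInv {n : ℕ} (hn : 2 < n) (X : Obj n) :
    Eqv hn X (.tensor X .top) (Raw.rhoInv X) (Raw.rhoInv X) :=
  Eqv.comp (Eqv.lamInv _) (Eqv.swap _ _)

/-- The associativity isomorphism. -/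
def assocIso {n : ℕ} {hn : 2 < n} (X Y Z : FR n hn) :
    FR.tensor (FR.tensor X Y) Z ≅ FR.tensor X (FR.tensor Y Z) where
  hom := Hom.mk (Raw.assoc X Y Z) (Eqv.assoc X Y Z)
  inv := Hom.mk (Raw.assocInv X Y Z) (Eqv.assocInv X Y Z)
  hom_inv_id := Hom.sound (Eqv.assoc_assocInv X Y Z) _ _
  inv_hom_id := Hom.sound (Eqv.assocInv_assoc X Y Z) _ _

/-- The left unit isomorphism. -/
def lamIso {n : ℕ} {hn : 2 < n} (X : FR n hn) : FR.tensor FR.top X ≅ X where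
  hom := Hom.mk (Raw.lam X) (Eqv.lam X)
  inv := Hom.mk (Raw.lamInv X) (Eqv.lamInv X)
  hom_inv_id := Hom.sound (Eqv.lam_lamInv X) _ _
  inv_hom_id := Hom.sound (Eqv.lamInv_lam X) _ _

/-- The symmetry isomorphism. -/
def swapIso {n : ℕ} {hn : 2 < n} (X Y : FR n hn) :
    FR.tensor X Y ≅ FR.tensor Y X where
  hom := Hom.mk (Raw.swap X Y) (Eqv.swap X Y)
  inv := Hom.mk (Raw.swap Y X) (Eqv.swap Y X)
  hom_inv_id := Hom.sound (Eqv.swap_swap X Y) _ _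
  inv_hom_id := Hom.sound (Eqv.swap_swap Y X) _ _

instance {n : ℕ} (hn : 2 < n) : MonoidalCategoryStruct (FR n hn) where
  tensorObj X Y := FR.tensor X Y
  tensorUnit := FR.top
  tensorHom f g := Hom.tens f g
  whiskerLeft X _ _ f := Hom.tens (𝟙 X) f
  whiskerRight f Y := Hom.tens f (𝟙 Y)
  associator X Y Z := assocIso X Y Z
  leftUnitor X := lamIso X
  rightUnitor X := swapIso X FR.top ≪≫ lamIso X

instance {n : ℕ} (hn : 2 < n) : MonoidalCategory (FR n hn) :=
  MonoidalCategory.ofTensorHom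
    (id_tensorHom_id := fun X Y => Hom.sound (Eqv.tens_id X Y) _ _)
    (id_tensorHom := fun _ _ _ _ => rfl)
    (tensorHom_id := fun _ _ => rfl)
    (tensorHom_comp_tensorHom := fun f₁ f₂ g₁ g₂ => by
      induction f₁ using Hom.ind with | _ t₁ h₁
      induction f₂ using Hom.ind with | _ t₂ h₂
      induction g₁ using Hom.ind with | _ u₁ k₁
      induction g₂ using Hom.ind with | _ u₂ k₂
      exact Hom.sound (Eqv.tens_comp h₁ k₁ h₂ k₂) _ _)
    (associator_naturality := fun f₁ f₂ f₃ => by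
      induction f₁ using Hom.ind with | _ t₁ h₁
      induction f₂ using Hom.ind with | _ t₂ h₂
      induction f₃ using Hom.ind with | _ t₃ h₃
      exact Hom.sound (Eqv.assoc_natural h₁ h₂ h₃) _ _)
    (leftUnitor_naturality := fun f => by
      induction f using Hom.ind with | _ t h
      exact Hom.sound (Eqv.lam_natural h) _ _)
    (rightUnitor_naturality := fun {X Y} f => by
      induction f using Hom.ind with | _ t h
      refine Hom.sound (u := Raw.comp (Raw.rho X) t) (t := Raw.comp (Raw.tens t (Raw.id .top))
        (Raw.rho Y)) ?_ _ _
      have e := Eqv.tens h (Eqv.id (hn := hn) Obj.top)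
      have e' := Eqv.tens (Eqv.id (hn := hn) Obj.top) h
      exact (Eqv.comp_assoc e (Eqv.swap _ _) (Eqv.lam _)).symm.trans
        (((Eqv.swap_natural h (Eqv.id _)).comp (Eqv.lam _)).trans
          ((Eqv.comp_assoc (Eqv.swap _ _) e' (Eqv.lam _)).trans
            (((Eqv.swap _ _).comp (Eqv.lam_natural h)).trans
              (Eqv.comp_assoc (Eqv.swap _ _) (Eqv.lam _) h).symm))))
    (pentagon := fun W X Y Z => Hom.sound (Eqv.pentagon W X Y Z) _ _)
    (triangle := fun X Y => Hom.sound (Eqv.triangle X Y) _ _)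

theorem swap_natural {n : ℕ} {hn : 2 < n} {X X' Y Y' : FR n hn} (f : X ⟶ X') (g : Y ⟶ Y') :
    (f ⊗ₘ g) ≫ (swapIso X' Y').hom = (swapIso X Y).hom ≫ (g ⊗ₘ f) := by
  induction f using Hom.ind with | _ t h
  induction g using Hom.ind with | _ u k
  exact Hom.sound (Eqv.swap_natural h k) _ _

theorem swap_hexagon {n : ℕ} {hn : 2 < n} (X Y Z : FR n hn) :
    (α_ X Y Z).hom ≫ (swapIso X (Y ⊗ Z)).hom ≫ (α_ Y Z X).hom =
      ((swapIso X Y).hom ▷ Z) ≫ (α_ Y X Z).hom ≫ (Y ◁ (swapIso X Z).hom) :=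
  Hom.sound (Eqv.hexagon X Y Z) _ _

instance {n : ℕ} (hn : 2 < n) : SymmetricCategory (FR n hn) where
  braiding X Y := swapIso X Y
  braiding_naturality_right X _ _ f := swap_natural (𝟙 X) f
  braiding_naturality_left f Z := swap_natural f (𝟙 Z)
  hexagon_forward X Y Z := swap_hexagon X Y Z
  hexagon_reverse X Y Z := by
    have h : α_ Z X Y ≪≫ swapIso Z (X ⊗ Y) ≪≫ α_ X Y Z =
        whiskerRightIso (swapIso Z X) Y ≪≫ α_ X Z Y ≪≫ whiskerLeftIso X (swapIso Z Y) := by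
      ext1
      exact swap_hexagon Z X Y
    have h' := congrArg Iso.inv h
    simp only [Iso.trans_inv, whiskerRightIso_inv, whiskerLeftIso_inv, Category.assoc] at h'
    exact h'
  symmetry X Y := (swapIso X Y).hom_inv_id

/-- The strict symmetric monoidal endofunctor of `FR^n` attached to an endofunctor `f` of the
ordinal `n`. -/
def actF {n : ℕ} (hn : 2 < n) (f : Fin n →o Fin n) : FR n hn ⥤ FR n hn where
  obj X := Obj.act f X
  map {X Y} t := Quotient.map (sa := homSetoid hn X Y) (sb := homSetoid hn (X.act f) (Y.act f))
    (fun t => ⟨Raw.act f t.1, Eqv.act f t.2⟩) (fun _ _ h => Eqv.act f h) t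
  map_id X := Hom.sound (Eqv.act_id f X) _ _
  map_comp t u := by
    induction t using Hom.ind with | _ t h
    induction u using Hom.ind with | _ u k
    exact Hom.sound (Eqv.act_comp f h k) _ _

/-- The symmetric monoidal transformation attached to `f ≤ g`. -/
def cellT {n : ℕ} (hn : 2 < n) {f g : Fin n →o Fin n} (h : f ≤ g) : actF hn f ⟶ actF hn g where
  app X := Hom.mk (Raw.cell f g X) (Eqv.cell h X)
  naturality X Y t := by
    induction t using Hom.ind with | _ t k
    exact (Hom.sound (Eqv.cell_natural h k) _ _).symm

/-! ### Levels, numerals and global sections -/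

theorem eqv_zeroAt {n : ℕ} (hn : 2 < n) (j : ℕ) (hj : j < n) :
    Eqv hn .top (.N ⟨j, hj⟩) (Raw.zeroAt j hj) (Raw.zeroAt j hj) := by
  induction j with
  | zero => exact Eqv.zero
  | succ j ih =>
    have h := Eqv.act (coG j hj) (ih (by omega))
    rw [act_coG_self] at h
    exact h

theorem eqv_succAt {n : ℕ} (hn : 2 < n) (j : ℕ) (hj : j < n) :
    Eqv hn (.N ⟨j, hj⟩) (.N ⟨j, hj⟩) (Raw.succAt j hj) (Raw.succAt j hj) := by
  induction j with
  | zero => exact Eqv.succ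
  | succ j ih =>
    have h := Eqv.act (coG j hj) (ih (by omega))
    rw [act_coG_self] at h
    exact h

/-- The level `N_k` of the natural numbers, as an object of `FR^n`. -/
def N {n : ℕ} (hn : 2 < n) (k : Fin n) : FR n hn := Obj.N k

/-- The zero `0_k : ⊤ ⟶ N_k`. -/
def zero {n : ℕ} (hn : 2 < n) (k : Fin n) : 𝟙_ (FR n hn) ⟶ N hn k :=
  Hom.mk (Raw.zeroAt k.1 k.2) (eqv_zeroAt hn k.1 k.2)

/-- The successor `s_k : N_k ⟶ N_k`. -/
def succ {n : ℕ} (hn : 2 < n) (k : Fin n) : N hn k ⟶ N hn k :=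
  Hom.mk (Raw.succAt k.1 k.2) (eqv_succAt hn k.1 k.2)

/-- The global sections functor `Γ = FR^n(⊤, -)`, with `Γ f = f ∘ -`. -/
def Γ {n : ℕ} (hn : 2 < n) : FR n hn ⥤ Type := coyoneda.obj (op (𝟙_ (FR n hn)))

/-- The numerals `std_k : ℕ → Γ N_k`, with `std_k 0 = 0_k` and `std_k (m + 1) = s_k ∘ std_k m`. -/
def std {n : ℕ} (hn : 2 < n) (k : Fin n) : ℕ → (Γ hn).obj (N hn k)
  | 0 => zero hn k
  | m + 1 => (Γ hn).map (succ hn k) (std hn k m)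

/-- The power `s_k^m : N_k ⟶ N_k`. -/
def succPow {n : ℕ} (hn : 2 < n) (k : Fin n) : ℕ → (N hn k ⟶ N hn k)
  | 0 => 𝟙 _
  | m + 1 => succPow hn k m ≫ succ hn k

end FRn

namespace FRn

variable {n : ℕ} {hn : 2 < n}

/-! The argument is a computability (logical relations) argument on formal terms. Call a global
section of an object a value if it is built from numerals and `id ⊤` by pairing. A term `t : X → Y`
is computable if, for every endofunctor `f` of the ordinal, the image of `t` under `f` carries
values of `X.act f` to values of `Y.act f`, up to provable equality. Quantifying over all `f` makes
computability stable under `act`, which plain preservation of values would not give. Every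
well-formed term is computable (`Eqv.computes`), and a computable `⊤ → N_k`, evaluated at `id ⊤`
with `f` the identity, equals a numeral.

Recursion is evaluated by counting up the numeral in the recursion argument; dependent recursion
also needs the diagonals to duplicate values (`maps_diag`). The transformations are handled by
naturality at numerals.

The main obstacle is that endofunctors must send numerals to numerals (`eqv_act_num`), while the
axioms fix only `0_{j+1} = G_j 0_j`, `s_{j+1} = G_j s_j` and the values of `T_0` at `0_0` and `s_0`.
The 2-cells close the gap: endofunctors with the same value at `N_0` agree on `0_0` and `s_0`
(`eqv_act_zero_succ`), so any image of a numeral can be compared with a known one. -/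

theorem eqv_of_mk_eq {X Y : Obj n} {t u : Raw n} {ht : Eqv hn X Y t t} {hu : Eqv hn X Y u u}
    (h : Hom.mk t ht = Hom.mk u hu) : Eqv hn X Y t u :=
  Quotient.exact (s := homSetoid hn X Y) h

/-! ### Pairs of global sections -/

namespace Raw

/-- The pair `⊤ → X ⊗ Y` of two global sections. -/
def pr (a b : Raw n) : Raw n := comp (lamInv .top) (tens a b)

/-- The numeral `i` of level `N_j`. -/
def num (j : Fin n) : ℕ → Raw n
  | 0 => zeroAt j.1 j.2
  | i + 1 => comp (num j i) (succAt j.1 j.2)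

/-- The zero of a level or of the unit. -/
def zeroO : Obj n → Raw n
  | .N j => zeroAt j.1 j.2
  | X => id X

/-- The successor of a level, or the identity of the unit. -/
def succO : Obj n → Raw n
  | .N j => succAt j.1 j.2
  | X => id X

/-- The numeral `i` of a level, or the identity of the unit. -/
def numO : Obj n → ℕ → Raw n
  | .N j, i => num j i
  | X, _ => id X

end Raw

open Raw

theorem eqv_pr {X Y : Obj n} {a a' b b' : Raw n} (ha : Eqv hn .top X a a')
    (hb : Eqv hn .top Y b b') : Eqv hn .top (.tensor X Y) (pr a b) (pr a' b') :=
  (Eqv.lamInv _).comp (ha.tens hb)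

theorem eqv_pr_tens {X Y X' Y' : Obj n} {a b t u : Raw n} (ha : Eqv hn .top X a a)
    (hb : Eqv hn .top Y b b) (ht : Eqv hn X X' t t) (hu : Eqv hn Y Y' u u) :
    Eqv hn .top (.tensor X' Y') (comp (pr a b) (tens t u)) (pr (comp a t) (comp b u)) :=
  (Eqv.comp_assoc (Eqv.lamInv _) (ha.tens hb) (ht.tens hu)).trans
    ((Eqv.lamInv _).comp (Eqv.tens_comp ha ht hb hu))

/-- Naturality moves the associator past `a`, `b`, `c`; what is left is a coherence identity between
maps out of `⊤`. It is stated in the category `FR n hn`, where coherence applies, and carried back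
to terms by `eqv_of_mk_eq`. -/
theorem pair_associator {X Y Z : FR n hn} (a : 𝟙_ (FR n hn) ⟶ X) (b : 𝟙_ (FR n hn) ⟶ Y)
    (c : 𝟙_ (FR n hn) ⟶ Z) :
    ((λ_ (𝟙_ (FR n hn))).inv ≫ (((λ_ (𝟙_ (FR n hn))).inv ≫ (a ⊗ₘ b)) ⊗ₘ c)) ≫ (α_ X Y Z).hom =
      (λ_ (𝟙_ (FR n hn))).inv ≫ (a ⊗ₘ ((λ_ (𝟙_ (FR n hn))).inv ≫ (b ⊗ₘ c))) := by
  have h1 : (((λ_ (𝟙_ (FR n hn))).inv ≫ (a ⊗ₘ b)) ⊗ₘ c) =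
      ((λ_ (𝟙_ (FR n hn))).inv ⊗ₘ 𝟙 _) ≫ ((a ⊗ₘ b) ⊗ₘ c) := by
    rw [tensorHom_comp_tensorHom, Category.id_comp]
  have h2 : (a ⊗ₘ ((λ_ (𝟙_ (FR n hn))).inv ≫ (b ⊗ₘ c))) =
      (𝟙 _ ⊗ₘ (λ_ (𝟙_ (FR n hn))).inv) ≫ (a ⊗ₘ (b ⊗ₘ c)) := by
    rw [tensorHom_comp_tensorHom, Category.id_comp]
  rw [h1, h2, Category.assoc, Category.assoc, associator_naturality]
  simp only [← Category.assoc]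
  congr 1
  monoidal

/-- After naturality only the braiding of `⊤` with itself remains, and it is the identity because
the two unitors agree at `⊤`. -/
theorem pair_braiding {X Y : FR n hn} (a : 𝟙_ (FR n hn) ⟶ X) (b : 𝟙_ (FR n hn) ⟶ Y) :
    ((λ_ (𝟙_ (FR n hn))).inv ≫ (a ⊗ₘ b)) ≫ (β_ X Y).hom =
      (λ_ (𝟙_ (FR n hn))).inv ≫ (b ⊗ₘ a) := by
  rw [Category.assoc, BraidedCategory.braiding_naturality, ← Category.assoc]
  congr 1
  rw [braiding_tensorUnit_left, unitors_equal]
  simp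

theorem eqv_pr_assoc {X Y Z : Obj n} {a b c : Raw n} (ha : Eqv hn .top X a a)
    (hb : Eqv hn .top Y b b) (hc : Eqv hn .top Z c c) :
    Eqv hn .top (.tensor X (.tensor Y Z)) (comp (pr (pr a b) c) (assoc X Y Z))
      (pr a (pr b c)) :=
  eqv_of_mk_eq (ht := (eqv_pr (eqv_pr ha hb) hc).comp (Eqv.assoc X Y Z))
    (hu := eqv_pr ha (eqv_pr hb hc)) (pair_associator (Hom.mk a ha) (Hom.mk b hb) (Hom.mk c hc))

theorem eqv_pr_swap {X Y : Obj n} {a b : Raw n} (ha : Eqv hn .top X a a)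
    (hb : Eqv hn .top Y b b) :
    Eqv hn .top (.tensor Y X) (comp (pr a b) (swap X Y)) (pr b a) :=
  eqv_of_mk_eq (ht := (eqv_pr ha hb).comp (Eqv.swap X Y))
    (hu := eqv_pr hb ha) (pair_braiding (Hom.mk a ha) (Hom.mk b hb))

theorem eqv_pr_lam {X : Obj n} {a : Raw n} (ha : Eqv hn .top X a a) :
    Eqv hn .top X (comp (pr (Raw.id .top) a) (lam X)) a :=
  (Eqv.comp_assoc (Eqv.lamInv _) ((Eqv.id _).tens ha) (Eqv.lam _)).trans
    (((Eqv.lamInv _).comp (Eqv.lam_natural ha)).trans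
      ((Eqv.comp_assoc (Eqv.lamInv _) (Eqv.lam _) ha).symm.trans
        (((Eqv.lamInv_lam _).comp ha).trans (Eqv.id_comp ha))))

/-! ### The endofunctors act on numerals by change of level -/

theorem act_N_congr {f g : Fin n →o Fin n} {j : Fin n} (h : ∀ i, f i ≤ j ↔ g i ≤ j) :
    (Obj.N j).act f = (Obj.N j).act g := by
  rcases act_N_exists g j with hg | ⟨m, hm⟩
  · rw [act_N_eq_top g j hg, act_N_eq_top f j fun i hi => hg i ((h i).1 hi)]
  · rw [act_N_eq g j m hm, act_N_eq f j m fun i => (h i).trans (hm i)]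

/-- Converse of `act_N_congr`: the object `N_j.act f` is `⊤` or `N_m`, and it encodes the down-set
of those `i` with `f i ≤ j`. -/
theorem le_iff_le_of_act_N_eq {f g : Fin n →o Fin n} {j : Fin n}
    (h : (Obj.N j).act f = (Obj.N j).act g) (i : Fin n) : f i ≤ j ↔ g i ≤ j := by
  rcases act_N_exists f j with hf | ⟨l, hl⟩ <;> rcases act_N_exists g j with hg | ⟨m, hm⟩
  · simp [hf i, hg i]
  · rw [act_N_eq_top f j hf, act_N_eq g j m hm] at h
    cases h
  · rw [act_N_eq_top g j hg, act_N_eq f j l hl] at h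
    cases h
  · rw [act_N_eq f j l hl, act_N_eq g j m hm] at h
    cases h
    exact (hl i).trans (hm i).symm

/-! ### Components of the transformations at `N_0`. -/

section

variable (hn)

/-- The endofunctor of the ordinal `n` that fixes `0` and sends the rest to `n - 1`. -/
def splitZero : Fin n →o Fin n where
  toFun i := if i.val = 0 then ⟨0, by omega⟩ else ⟨n - 1, by omega⟩
  monotone' := by
    intro a b hab
    have h : a.val ≤ b.val := hab
    by_cases h1 : a.val = 0 <;> by_cases h2 : b.val = 0 <;>
      simp only [h1, h2, if_true, if_false, le_refl, Fin.le_def] <;> omega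

theorem splitZero_val (i : Fin n) :
    (splitZero hn i).val = if i.val = 0 then 0 else n - 1 := by
  change (if i.val = 0 then (⟨0, _⟩ : Fin n) else ⟨n - 1, _⟩).val = _
  split_ifs <;> rfl

theorem act_splitZero :
    (Obj.N ⟨0, by omega⟩).act (splitZero hn) = (Obj.N ⟨0, by omega⟩ : Obj n) := by
  apply act_N_eq
  intro i
  rw [Fin.le_def, Fin.le_def, splitZero_val]
  dsimp only
  split_ifs <;> omega

end

/-- Since `splitZero` fixes `N_0`, the component of `f ≤ g` at `N_0` is also the component of the
whiskered 2-cell from `splitZero ∘ f` to `splitZero ∘ g`. These two endofunctors coincide, so that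
2-cell is an identity. -/
theorem eqv_cell_id {f g : Fin n →o Fin n} (hfg : f ≤ g)
    (h : (Obj.N ⟨0, by omega⟩).act f = (Obj.N ⟨0, by omega⟩ : Obj n).act g) :
    Eqv hn ((Obj.N ⟨0, by omega⟩).act f) ((Obj.N ⟨0, by omega⟩).act f)
      (cell f g (.N ⟨0, by omega⟩)) (Raw.id ((Obj.N ⟨0, by omega⟩).act f)) := by
  -- Composing with `splitZero` remembers only which `i` go to `0`, and by `h` these are the same
  -- for `f` and `g`.
  have e : (splitZero hn).comp f = (splitZero hn).comp g := by
    ext i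
    have hi := le_iff_le_of_act_N_eq h i
    simp only [Fin.le_def, Nat.le_zero] at hi
    change (splitZero hn (f i)).val = (splitZero hn (g i)).val
    simp only [splitZero_val, hi]
  have k := Eqv.cell_act (hn := hn) hfg (splitZero hn) (.N ⟨0, by omega⟩)
  rw [act_splitZero, e, ← h] at k
  refine k.trans ?_
  have k' := Eqv.cell_refl (hn := hn) ((splitZero hn).comp g) (.N ⟨0, by omega⟩)
  rwa [← Obj.act_act, act_splitZero, ← h] at k'

/-- If the components of `f ≤ g` at `X` and `Y` are identities, then `f` and `g` agree on morphisms
`X → Y`. -/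
theorem eqv_act_of_cell_id {f g : Fin n →o Fin n} (hfg : f ≤ g) {X Y : Obj n} {t : Raw n}
    (ht : Eqv hn X Y t t) (hX : X.act f = X.act g) (hY : Y.act f = Y.act g)
    (cX : Eqv hn (X.act f) (X.act f) (cell f g X) (Raw.id (X.act f)))
    (cY : Eqv hn (Y.act f) (Y.act f) (cell f g Y) (Raw.id (Y.act f))) :
    Eqv hn (X.act f) (Y.act f) (act f t) (act g t) := by
  have h := Eqv.cell_natural hfg ht
  have hf := ht.act f
  have hg := ht.act g
  rw [← hX, ← hY] at hg
  rw [← hY] at h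
  exact (Eqv.comp_id hf).symm.trans ((hf.comp cY.symm).trans
    (h.symm.trans ((cX.comp hg).trans (Eqv.id_comp hg))))

theorem eqv_act_zero_succ_of_le {f g : Fin n →o Fin n} (hfg : f ≤ g)
    (h : (Obj.N ⟨0, by omega⟩).act f = (Obj.N ⟨0, by omega⟩ : Obj n).act g) :
    Eqv hn .top ((Obj.N ⟨0, by omega⟩).act f) (act f Raw.zero) (act g Raw.zero) ∧
    Eqv hn ((Obj.N ⟨0, by omega⟩).act f) ((Obj.N ⟨0, by omega⟩).act f)
      (act f Raw.succ) (act g Raw.succ) :=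
  ⟨eqv_act_of_cell_id hfg Eqv.zero rfl h (Eqv.cell_top hfg) (eqv_cell_id hfg h),
    eqv_act_of_cell_id hfg Eqv.succ h h (eqv_cell_id hfg h) (eqv_cell_id hfg h)⟩

/-- The values of an endofunctor at `0_0` and `s_0` depend only on its value at `N_0`. -/
theorem eqv_act_zero_succ {f g : Fin n →o Fin n}
    (h : (Obj.N ⟨0, by omega⟩).act f = (Obj.N ⟨0, by omega⟩ : Obj n).act g) :
    Eqv hn .top ((Obj.N ⟨0, by omega⟩).act f) (act f Raw.zero) (act g Raw.zero) ∧
    Eqv hn ((Obj.N ⟨0, by omega⟩).act f) ((Obj.N ⟨0, by omega⟩).act f)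
      (act f Raw.succ) (act g Raw.succ) := by
  -- There may be no 2-cell between `f` and `g`, so both are compared with `f ⊔ g`, which has the
  -- same preimage of `0`.
  have hs : (Obj.N ⟨0, by omega⟩).act f = (Obj.N ⟨0, by omega⟩ : Obj n).act (f ⊔ g) := by
    apply act_N_congr
    intro i
    change _ ↔ f i ⊔ g i ≤ _
    rw [sup_le_iff, ← le_iff_le_of_act_N_eq h i, and_self]
  have h1 := eqv_act_zero_succ_of_le (hn := hn) (le_sup_left : f ≤ f ⊔ g) hs
  have h2 := eqv_act_zero_succ_of_le (hn := hn) (le_sup_right : g ≤ f ⊔ g) (h ▸ hs)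
  rw [← h] at h2
  exact ⟨h1.1.trans h2.1.symm, h1.2.trans h2.2.symm⟩

variable (hn) in
-- Unrolling the definition, `e = G_0 ∘ ⋯ ∘ G_{j-1}`. All levels of zero and successor are thus
-- images of `0_0` and `s_0` under a single endofunctor.
theorem exists_eqv_act_zero_succ (j : ℕ) (hj : j < n) :
    ∃ e : Fin n →o Fin n, (Obj.N ⟨0, by omega⟩).act e = Obj.N ⟨j, hj⟩ ∧
      Eqv hn .top (.N ⟨j, hj⟩) (zeroAt j hj) (act e Raw.zero) ∧
      Eqv hn (.N ⟨j, hj⟩) (.N ⟨j, hj⟩) (succAt j hj) (act e Raw.succ) := by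
  induction j with
  | zero =>
    exact ⟨OrderHom.id, Obj.act_id _, (Eqv.act_one Eqv.zero).symm, (Eqv.act_one Eqv.succ).symm⟩
  | succ j ih =>
    obtain ⟨e, he, hz, hs⟩ := ih (by omega)
    have k1 := hz.act (coG j hj)
    have k2 := hs.act (coG j hj)
    have k3 := Eqv.act_act (coG j hj) e (Eqv.zero (hn := hn))
    have k4 := Eqv.act_act (coG j hj) e (Eqv.succ (hn := hn))
    rw [act_coG_self] at k1 k2
    rw [he, act_coG_self] at k3 k4
    exact ⟨e.comp (coG j hj), by rw [← Obj.act_act, he, act_coG_self], k1.trans k3, k2.trans k4⟩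

theorem act_N_cases (f : Fin n →o Fin n) (j : Fin n) :
    (Obj.N j).act f = Obj.top ∨ ∃ m, (Obj.N j).act f = Obj.N m := by
  rcases act_N_exists f j with h | ⟨m, hm⟩
  · exact Or.inl (act_N_eq_top f j h)
  · exact Or.inr ⟨m, act_N_eq f j m hm⟩

/-- With `0_j` and `s_j` the images of `0_0` and `s_0` under `e`, the images under `f` are those
under `e ∘ f`. By `eqv_act_zero_succ` this composite may be replaced by any endofunctor with the
same value at `N_0`: by `T_0` if that value is `⊤`, where the axioms give identities, and by the
endofunctor defining level `m` if it is `N_m`. -/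
theorem eqv_act_zeroAt_succAt (hn : 2 < n) (f : Fin n →o Fin n) (j : ℕ) (hj : j < n) :
    Eqv hn .top ((Obj.N ⟨j, hj⟩).act f) (act f (zeroAt j hj)) (zeroO ((Obj.N ⟨j, hj⟩).act f)) ∧
    Eqv hn ((Obj.N ⟨j, hj⟩).act f) ((Obj.N ⟨j, hj⟩).act f) (act f (succAt j hj))
      (succO ((Obj.N ⟨j, hj⟩).act f)) := by
  obtain ⟨e, he, hz, hs⟩ := exists_eqv_act_zero_succ hn j hj
  have hef : (Obj.N ⟨0, by omega⟩).act (e.comp f) = (Obj.N ⟨j, hj⟩).act f := by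
    rw [← Obj.act_act, he]
  have k1 := (hz.act f).trans (he ▸ Eqv.act_act f e (Eqv.zero (hn := hn)))
  have k2 := (hs.act f).trans (he ▸ Eqv.act_act f e (Eqv.succ (hn := hn)))
  rcases act_N_cases f ⟨j, hj⟩ with h | ⟨m, h⟩
  · have hT := eqv_act_zero_succ (hn := hn) (f := e.comp f) (g := coT 0 (by omega))
      (by rw [hef, h, act_coT_zero])
    rw [h] at k1 k2 hef ⊢
    rw [hef] at hT
    exact ⟨k1.trans (hT.1.trans Eqv.coT_zero), k2.trans (hT.2.trans Eqv.coT_succ)⟩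
  · obtain ⟨e', he', hz', hs'⟩ := exists_eqv_act_zero_succ hn m.1 m.2
    have hT := eqv_act_zero_succ (hn := hn) (f := e.comp f) (g := e') (by rw [hef, h, he'])
    rw [h] at k1 k2 hef ⊢
    rw [hef] at hT
    exact ⟨k1.trans (hT.1.trans hz'.symm), k2.trans (hT.2.trans hs'.symm)⟩

theorem numO_zero (X : Obj n) : numO X 0 = zeroO X := by cases X <;> rfl

theorem eqv_num (hn : 2 < n) (j : Fin n) (i : ℕ) : Eqv hn .top (.N j) (num j i) (num j i) := by
  induction i with
  | zero => exact eqv_zeroAt hn j.1 j.2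
  | succ i ih => exact ih.comp (eqv_succAt hn j.1 j.2)

theorem eqv_numO (hn : 2 < n) (f : Fin n →o Fin n) (j : Fin n) (i : ℕ) :
    Eqv hn .top ((Obj.N j).act f) (numO ((Obj.N j).act f) i) (numO ((Obj.N j).act f) i) := by
  rcases act_N_cases f j with h | ⟨m, h⟩ <;> rw [h]
  · exact Eqv.id _
  · exact eqv_num hn m i

theorem eqv_numO_succ (hn : 2 < n) (f : Fin n →o Fin n) (j : Fin n) (i : ℕ) :
    Eqv hn .top ((Obj.N j).act f)
      (comp (numO ((Obj.N j).act f) i) (succO ((Obj.N j).act f)))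
      (numO ((Obj.N j).act f) (i + 1)) := by
  rcases act_N_cases f j with h | ⟨m, h⟩ <;> rw [h]
  · exact Eqv.id_comp (Eqv.id _)
  · exact eqv_num hn m (i + 1)

theorem eqv_act_num (hn : 2 < n) (f : Fin n →o Fin n) (j : Fin n) (i : ℕ) :
    Eqv hn .top ((Obj.N j).act f) (act f (num j i)) (numO ((Obj.N j).act f) i) := by
  have h := eqv_act_zeroAt_succAt hn f j.1 j.2
  induction i with
  | zero =>
    rw [numO_zero]
    exact h.1
  | succ i ih =>
    exact (Eqv.act_comp f (eqv_num hn j i) (eqv_succAt hn j.1 j.2)).trans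
      ((ih.comp h.2).trans (eqv_numO_succ hn f j i))

/-! ### Values -/

/-- The values of an object: the global sections built from numerals by pairing. -/
def Val : Obj n → Raw n → Prop
  | .top, v => v = Raw.id .top
  | .N j, v => ∃ i, v = num j i
  | .tensor X Y, v => ∃ a b, Val X a ∧ Val Y b ∧ v = pr a b

theorem Val.eqv (hn : 2 < n) {X : Obj n} {v : Raw n} (h : Val X v) : Eqv hn .top X v v := by
  induction X generalizing v with
  | top =>
    cases h
    exact Eqv.id _
  | N j =>
    obtain ⟨i, rfl⟩ := h
    exact eqv_num hn j i
  | tensor X Y hX hY =>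
    obtain ⟨a, b, ha, hb, rfl⟩ := h
    exact eqv_pr (hX ha) (hY hb)

theorem val_numO (f : Fin n →o Fin n) (j : Fin n) (i : ℕ) :
    Val ((Obj.N j).act f) (numO ((Obj.N j).act f) i) := by
  rcases act_N_cases f j with h | ⟨m, h⟩ <;> rw [h]
  · rfl
  · exact ⟨i, rfl⟩

theorem Val.exists_numO {f : Fin n →o Fin n} {j : Fin n} {v : Raw n}
    (h : Val ((Obj.N j).act f) v) : ∃ i, v = numO ((Obj.N j).act f) i := by
  rcases act_N_cases f j with e | ⟨m, e⟩ <;> rw [e] at h ⊢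
  · exact ⟨0, h⟩
  · exact h

/-- `Maps hn f X Y t v w` says that `t : X → Y`, and that the image of `t` under the endofunctor
attached to `f` sends the global section `v` to `w`. -/
structure Maps (hn : 2 < n) (f : Fin n →o Fin n) (X Y : Obj n) (t v w : Raw n) : Prop where
  typed : Eqv hn X Y t t
  source : Eqv hn .top (X.act f) v v
  eqv : Eqv hn .top (Y.act f) (comp v (act f t)) w

/-! ### Evaluating images of structural terms on global sections. -/

namespace Maps

variable {f : Fin n →o Fin n} {X Y Z X' Y' : Obj n} {t u v w x v' w' : Raw n}

theorem target (h : Maps hn f X Y t v w) : Eqv hn .top (Y.act f) w w := h.eqv.symm.left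

theorem congr (h : Maps hn f X Y t v w) (e : Eqv hn X Y t u) : Maps hn f X Y u v w :=
  ⟨e.symm.left, h.source, (h.source.comp (e.symm.act f)).trans h.eqv⟩

theorem id (hv : Eqv hn .top (X.act f) v v) : Maps hn f X X (Raw.id X) v v :=
  ⟨Eqv.id X, hv, (hv.comp (Eqv.act_id f X)).trans (Eqv.comp_id hv)⟩

theorem comp_eqv (hv : Eqv hn .top (X.act f) v v) (ht : Eqv hn X Y t t) (hu : Eqv hn Y Z u u) :
    Eqv hn .top (Z.act f) (Raw.comp v (act f (Raw.comp t u)))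
      (Raw.comp (Raw.comp v (act f t)) (act f u)) :=
  (hv.comp (Eqv.act_comp f ht hu)).trans (Eqv.comp_assoc hv (ht.act f) (hu.act f)).symm

theorem comp (h : Maps hn f X Y t v w) (h' : Maps hn f Y Z u w x) :
    Maps hn f X Z (comp t u) v x :=
  ⟨h.typed.comp h'.typed, h.source,
    (comp_eqv h.source h.typed h'.typed).trans ((h.eqv.comp (h'.typed.act f)).trans h'.eqv)⟩

/-- Reads an equation backwards: the effect of `u` on `w` is known once `w` is reached through some
`t` whose composite with `u` is understood. Inverse isomorphisms and recursors are evaluated this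
way. -/
theorem of_comp (hu : Eqv hn Y Z u u) (h' : Maps hn f X Z (Raw.comp t u) v x)
    (h : Maps hn f X Y t v w) : Maps hn f Y Z u w x :=
  ⟨hu, h.target, ((h.eqv.symm.comp (hu.act f)).trans
    (comp_eqv h.source h.typed hu).symm).trans h'.eqv⟩

theorem tens (h : Maps hn f X Y t v w) (h' : Maps hn f X' Y' u v' w') :
    Maps hn f (.tensor X X') (.tensor Y Y') (tens t u) (pr v v') (pr w w') :=
  ⟨h.typed.tens h'.typed, eqv_pr h.source h'.source,
    ((eqv_pr h.source h'.source).comp (Eqv.act_tens f h.typed h'.typed)).trans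
      ((eqv_pr_tens h.source h'.source (h.typed.act f) (h'.typed.act f)).trans
        (eqv_pr h.eqv h'.eqv))⟩

theorem assoc (hv : Eqv hn .top (X.act f) v v) (hw : Eqv hn .top (Y.act f) w w)
    (hx : Eqv hn .top (Z.act f) x x) :
    Maps hn f (.tensor (.tensor X Y) Z) (.tensor X (.tensor Y Z)) (assoc X Y Z)
      (pr (pr v w) x) (pr v (pr w x)) :=
  have h := eqv_pr (eqv_pr hv hw) hx
  ⟨Eqv.assoc X Y Z, h, (h.comp (Eqv.act_assoc f X Y Z)).trans (eqv_pr_assoc hv hw hx)⟩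

/-- No axiom says directly that the endofunctors preserve `assocInv`; its effect follows from its
being inverse to `assoc`. -/
theorem assocInv (hv : Eqv hn .top (X.act f) v v) (hw : Eqv hn .top (Y.act f) w w)
    (hx : Eqv hn .top (Z.act f) x x) :
    Maps hn f (.tensor X (.tensor Y Z)) (.tensor (.tensor X Y) Z) (assocInv X Y Z)
      (pr v (pr w x)) (pr (pr v w) x) :=
  of_comp (Eqv.assocInv X Y Z) ((Maps.id (eqv_pr (eqv_pr hv hw) hx)).congr
    (Eqv.assoc_assocInv X Y Z).symm) (Maps.assoc hv hw hx)

theorem lam (hv : Eqv hn .top (X.act f) v v) :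
    Maps hn f (.tensor .top X) X (lam X) (pr (Raw.id .top) v) v :=
  have h := eqv_pr (Eqv.id .top) hv
  ⟨Eqv.lam X, h, (h.comp (Eqv.act_lam f X)).trans (eqv_pr_lam hv)⟩

theorem lamInv (hv : Eqv hn .top (X.act f) v v) :
    Maps hn f X (.tensor .top X) (lamInv X) v (pr (Raw.id .top) v) :=
  of_comp (Eqv.lamInv X) ((Maps.id (eqv_pr (Eqv.id .top) hv)).congr
    (Eqv.lam_lamInv X).symm) (Maps.lam hv)

theorem swap (hv : Eqv hn .top (X.act f) v v) (hw : Eqv hn .top (Y.act f) w w) :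
    Maps hn f (.tensor X Y) (.tensor Y X) (swap X Y) (pr v w) (pr w v) :=
  have h := eqv_pr hv hw
  ⟨Eqv.swap X Y, h, (h.comp (Eqv.act_swap f X Y)).trans (eqv_pr_swap hv hw)⟩

/-- The image under `f` of the image under `g` is the image under `g.comp f`, so a statement at the
composite becomes one at `f`. -/
theorem act {g : Fin n →o Fin n} (h : Maps hn (g.comp f) X Y t v w) :
    Maps hn f (X.act g) (Y.act g) (act g t) v w := by
  have hs := h.source
  have he := h.eqv
  rw [← Obj.act_act] at hs he
  exact ⟨h.typed.act g, hs, (hs.comp (Eqv.act_act f g h.typed)).trans he⟩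

theorem mid {a b c d : Raw n} (ha : Eqv hn .top (X.act f) a a) (hb : Eqv hn .top (Y.act f) b b)
    (hc : Eqv hn .top (X'.act f) c c) (hd : Eqv hn .top (Y'.act f) d d) :
    Maps hn f (.tensor (.tensor X Y) (.tensor X' Y')) (.tensor (.tensor X X') (.tensor Y Y'))
      (mid X Y X' Y') (pr (pr a b) (pr c d)) (pr (pr a c) (pr b d)) :=
  (Maps.assoc (Z := .tensor X' Y') ha hb (eqv_pr hc hd)).comp
    (((Maps.id ha).tens ((Maps.assocInv hb hc hd).comp
      (((Maps.swap hb hc).tens (Maps.id hd)).comp (Maps.assoc hc hb hd)))).comp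
      (Maps.assocInv (Z := .tensor Y Y') ha hc (eqv_pr hb hd)))

theorem zeroAt (hn : 2 < n) (f : Fin n →o Fin n) (j : ℕ) (hj : j < n) :
    Maps hn f .top (.N ⟨j, hj⟩) (zeroAt j hj) (Raw.id .top)
      (numO ((Obj.N ⟨j, hj⟩).act f) 0) := by
  have h := (eqv_zeroAt hn j hj).act f
  rw [numO_zero]
  exact ⟨eqv_zeroAt hn j hj, Eqv.id .top,
    (Eqv.id_comp h).trans (eqv_act_zeroAt_succAt hn f j hj).1⟩

theorem succAt (hn : 2 < n) (f : Fin n →o Fin n) (j : ℕ) (hj : j < n) (i : ℕ) :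
    Maps hn f (.N ⟨j, hj⟩) (.N ⟨j, hj⟩) (succAt j hj)
      (numO ((Obj.N ⟨j, hj⟩).act f) i) (numO ((Obj.N ⟨j, hj⟩).act f) (i + 1)) :=
  have h := eqv_numO hn f ⟨j, hj⟩ i
  ⟨eqv_succAt hn j hj, h, (h.comp (eqv_act_zeroAt_succAt hn f j hj).2).trans
    (eqv_numO_succ hn f ⟨j, hj⟩ i)⟩

/-- Together with `rec_succ` this serves all the recursion schemes: only the defining equations are
used, `r` being any term that satisfies them. -/
theorem rec_zero {r g : Raw n} {j : ℕ} {hj : j < n}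
    (hr : Eqv hn (.tensor (.N ⟨j, hj⟩) X) Y r r)
    (e : Eqv hn (.tensor .top X) Y (Raw.comp (Raw.tens (Raw.zeroAt j hj) (Raw.id X)) r)
      (Raw.comp (Raw.lam X) g))
    (h : Maps hn f X Y g v w) :
    Maps hn f (.tensor (.N ⟨j, hj⟩) X) Y r (pr (numO ((Obj.N ⟨j, hj⟩).act f) 0) v) w :=
  of_comp hr (((Maps.lam h.source).comp h).congr e.symm)
    ((Maps.zeroAt hn f j hj).tens (Maps.id h.source))

theorem rec_succ {r s : Raw n} {j : ℕ} {hj : j < n} {i : ℕ}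
    (hr : Eqv hn (.tensor (.N ⟨j, hj⟩) X) Y r r)
    (e : Eqv hn (.tensor (.N ⟨j, hj⟩) X) Y
      (Raw.comp (Raw.tens (Raw.succAt j hj) (Raw.id X)) r) s)
    (hv : Eqv hn .top (X.act f) v v)
    (h : Maps hn f (.tensor (.N ⟨j, hj⟩) X) Y s (pr (numO ((Obj.N ⟨j, hj⟩).act f) i) v) w) :
    Maps hn f (.tensor (.N ⟨j, hj⟩) X) Y r (pr (numO ((Obj.N ⟨j, hj⟩).act f) (i + 1)) v) w :=
  of_comp hr (h.congr e.symm) ((Maps.succAt hn f j hj i).tens (Maps.id hv))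

end Maps

/-! ### Diagonals duplicate values -/

theorem act_tensor (f : Fin n →o Fin n) (X Y : Obj n) :
    (Obj.tensor X Y).act f = .tensor (X.act f) (Y.act f) := rfl

theorem collapse_N (k : ℕ) (hk : k + 1 < n) :
    (Obj.N ⟨k, by omega⟩ : Obj n).collapse k hk = .top := by
  induction k with
  | zero => exact act_coT_zero hk
  | succ k ih =>
    rw [Obj.collapse, act_coT_succ]
    exact ih _

theorem collapse_tensor (k : ℕ) (hk : k + 1 < n) (X Y : Obj n) :
    (Obj.tensor X Y).collapse k hk = .tensor (X.collapse k hk) (Y.collapse k hk) := by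
  induction k generalizing X Y with
  | zero => rfl
  | succ k ih =>
    rw [Obj.collapse, act_tensor, ih]
    rfl

/-- The bounding condition holds because `N_k ⊗ N_k` collapses to `⊤ ⊗ ⊤`, which the left unit
identifies with `⊤`. -/
theorem eqv_srr_diag (hn : 2 < n) (k : ℕ) (hk : k + 1 < n) :
    Eqv hn (.tensor (.N ⟨k + 1, hk⟩) .top) (.tensor (.N ⟨k, by omega⟩) (.N ⟨k, by omega⟩))
      (srr k (pr (zeroAt k (by omega)) (zeroAt k (by omega)))
        (tens (succAt k (by omega)) (succAt k (by omega))))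
      (srr k (pr (zeroAt k (by omega)) (zeroAt k (by omega)))
        (tens (succAt k (by omega)) (succAt k (by omega)))) := by
  have e : (Obj.tensor (.N ⟨k, by omega⟩) (.N ⟨k, by omega⟩) : Obj n).collapse k hk =
      .tensor .top .top := by
    rw [collapse_tensor, collapse_N]
  have hz := eqv_zeroAt hn k (by omega)
  have hs := eqv_succAt hn k (by omega)
  refine Eqv.srr hk (i := lam .top) (j := lamInv .top) ?_ ?_ ?_ ?_ (eqv_pr hz hz) (hs.tens hs)
  · rw [e]
    exact Eqv.lam _
  · rw [e]
    exact Eqv.lamInv _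
  · rw [e]
    exact Eqv.lam_lamInv _
  · exact Eqv.lamInv_lam _

theorem maps_srr_diag (hn : 2 < n) (k : ℕ) (hk : k + 1 < n) (f : Fin n →o Fin n) (i : ℕ) :
    Maps hn f (.tensor (.N ⟨k + 1, hk⟩) .top)
      (.tensor (.N ⟨k, by omega⟩) (.N ⟨k, by omega⟩))
      (srr k (pr (zeroAt k (by omega)) (zeroAt k (by omega)))
        (tens (succAt k (by omega)) (succAt k (by omega))))
      (pr (numO ((Obj.N ⟨k + 1, hk⟩).act f) i) (Raw.id .top))
      (pr (numO ((Obj.N ⟨k, by omega⟩).act f) i) (numO ((Obj.N ⟨k, by omega⟩).act f) i)) := by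
  have hr := eqv_srr_diag hn k hk
  have hz := eqv_zeroAt hn k (by omega)
  have hs := eqv_succAt hn k (by omega)
  have mz := Maps.zeroAt hn f k (by omega)
  induction i with
  | zero =>
    exact Maps.rec_zero hr (Eqv.srr_zero hk (eqv_pr hz hz) (hs.tens hs) hr)
      ((Maps.lamInv (Eqv.id .top)).comp (mz.tens mz))
  | succ i ih =>
    have ms := Maps.succAt hn f k (by omega) i
    exact Maps.rec_succ hr (Eqv.srr_succ hk (eqv_pr hz hz) (hs.tens hs) hr) (Eqv.id .top)
      (ih.comp (ms.tens ms))

/-- The recursion `d` turns the numeral `i` of level `k + 1` into two copies of `i` at level `k`.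
Applying `G_k` raises `N_k` to `N_{k+1}` and fixes `N_{k+1}`, so source and targets come to the same
level. -/
theorem maps_diagSucc (hn : 2 < n) (k : ℕ) (hk : k + 1 < n) (f : Fin n →o Fin n) {v : Raw n}
    (hv : Val ((Obj.N ⟨k + 1, hk⟩).act f) v) :
    Maps hn f (.N ⟨k + 1, hk⟩) (.tensor (.N ⟨k + 1, hk⟩) (.N ⟨k + 1, hk⟩)) (diagSucc k hk) v
      (pr v v) := by
  obtain ⟨i, rfl⟩ := hv.exists_numO
  have hs := act_coG_self (n := n) k hk
  have hne := act_coG_ne k hk ⟨k + 1, hk⟩ (by simp)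
  have e1 : (Obj.N ⟨k + 1, hk⟩ : Obj n).act ((coG k hk).comp f) =
      (Obj.N ⟨k + 1, hk⟩).act f := by
    rw [← Obj.act_act, hne]
  have e2 : (Obj.N ⟨k, by omega⟩ : Obj n).act ((coG k hk).comp f) =
      (Obj.N ⟨k + 1, hk⟩).act f := by
    rw [← Obj.act_act, hs]
  have h0 := eqv_numO hn ((coG k hk).comp f) ⟨k + 1, hk⟩ i
  have h := ((Maps.lamInv h0).comp (Maps.swap (Eqv.id .top) h0)).comp
    (maps_srr_diag hn k hk ((coG k hk).comp f) i)
  have h' := h.act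
  rw [e1, e2, hne, act_tensor, hs] at h'
  exact h'

theorem maps_diag (hn : 2 < n) (f : Fin n →o Fin n) (X : Obj n) {v : Raw n}
    (hv : Val (X.act f) v) : Maps hn f X (.tensor X X) (diag hn X) v (pr v v) := by
  induction X generalizing v with
  | top =>
    cases hv
    exact Maps.lamInv (Eqv.id .top)
  | N j =>
    obtain ⟨j, hj⟩ := j
    cases j with
    | succ k => exact maps_diagSucc hn k hj f hv
    | zero =>
      -- `N_0` is rewritten as `T_1 N_1`, so that the diagonal of `N_1` can be evaluated at the
      -- composite of `T_1` and `f`.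
      have e := act_coT_succ (n := n) 0 hn
      rw [← e, Obj.act_act] at hv
      have h := (maps_diagSucc hn 0 (by omega) _ hv).act
      rw [act_tensor, e] at h
      exact h
  | tensor X Y hX hY =>
    obtain ⟨a, b, ha, hb, rfl⟩ := hv
    have ha' := ha.eqv hn
    have hb' := hb.eqv hn
    exact ((hX ha).tens (hY hb)).comp (Maps.mid ha' ha' hb' hb')

/-! ### Formal morphisms send values to values -/

/-- `t : X → Y`, and all the images of `t` under the endofunctors attached to the endofunctors of
the ordinal send values to values. -/
def Computes (hn : 2 < n) (X Y : Obj n) (t : Raw n) : Prop :=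
  ∀ f v, Val (X.act f) v → ∃ w, Val (Y.act f) w ∧ Maps hn f X Y t v w

/-! ### Closure of computability under the term formers. -/

namespace Computes

variable {X Y Z X' Y' : Obj n} {t u : Raw n}

theorem congr (h : Computes hn X Y t) (e : Eqv hn X Y t u) : Computes hn X Y u :=
  fun f v hv =>
    let ⟨w, hw, m⟩ := h f v hv
    ⟨w, hw, m.congr e⟩

theorem id (X : Obj n) : Computes hn X X (Raw.id X) :=
  fun _ v hv => ⟨v, hv, Maps.id (hv.eqv hn)⟩

theorem comp (h : Computes hn X Y t) (h' : Computes hn Y Z u) :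
    Computes hn X Z (comp t u) := fun f v hv =>
  let ⟨w, hw, m⟩ := h f v hv
  let ⟨x, hx, m'⟩ := h' f w hw
  ⟨x, hx, m.comp m'⟩

theorem tens (h : Computes hn X Y t) (h' : Computes hn X' Y' u) :
    Computes hn (.tensor X X') (.tensor Y Y') (tens t u) := by
  rintro f _ ⟨a, b, ha, hb, rfl⟩
  obtain ⟨w, hw, m⟩ := h f a ha
  obtain ⟨x, hx, m'⟩ := h' f b hb
  exact ⟨_, ⟨w, x, hw, hx, rfl⟩, m.tens m'⟩

theorem assoc (X Y Z : Obj n) :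
    Computes hn (.tensor (.tensor X Y) Z) (.tensor X (.tensor Y Z)) (assoc X Y Z) := by
  rintro f _ ⟨_, c, ⟨a, b, ha, hb, rfl⟩, hc, rfl⟩
  exact ⟨_, ⟨a, _, ha, ⟨b, c, hb, hc, rfl⟩, rfl⟩,
    Maps.assoc (ha.eqv hn) (hb.eqv hn) (hc.eqv hn)⟩

theorem assocInv (X Y Z : Obj n) :
    Computes hn (.tensor X (.tensor Y Z)) (.tensor (.tensor X Y) Z) (assocInv X Y Z) := by
  rintro f _ ⟨a, _, ha, ⟨b, c, hb, hc, rfl⟩, rfl⟩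
  exact ⟨_, ⟨_, c, ⟨a, b, ha, hb, rfl⟩, hc, rfl⟩,
    Maps.assocInv (ha.eqv hn) (hb.eqv hn) (hc.eqv hn)⟩

theorem lam (X : Obj n) : Computes hn (.tensor .top X) X (lam X) := by
  rintro f _ ⟨_, b, rfl, hb, rfl⟩
  exact ⟨b, hb, Maps.lam (hb.eqv hn)⟩

theorem lamInv (X : Obj n) : Computes hn X (.tensor .top X) (lamInv X) :=
  fun _ v hv => ⟨_, ⟨_, v, rfl, hv, rfl⟩, Maps.lamInv (hv.eqv hn)⟩

theorem swap (X Y : Obj n) : Computes hn (.tensor X Y) (.tensor Y X) (swap X Y) := by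
  rintro f _ ⟨a, b, ha, hb, rfl⟩
  exact ⟨_, ⟨b, a, hb, ha, rfl⟩, Maps.swap (ha.eqv hn) (hb.eqv hn)⟩

/-- This is where the quantification over all endofunctors is spent: the hypothesis is used at
`g.comp f`. -/
theorem act (h : Computes hn X Y t) (g : Fin n →o Fin n) :
    Computes hn (X.act g) (Y.act g) (act g t) := by
  intro f v hv
  rw [Obj.act_act] at hv
  obtain ⟨w, hw, m⟩ := h _ v hv
  rw [← Obj.act_act] at hw
  exact ⟨w, hw, m.act⟩

/-- A transformation attached to `f ≤ g` sends values to values. -/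
theorem exists_val_cell {f g : Fin n →o Fin n} (h : f ≤ g) (X : Obj n) {v : Raw n}
    (hv : Val (X.act f) v) :
    ∃ w, Val (X.act g) w ∧ Eqv hn .top (X.act g) (Raw.comp v (cell f g X)) w := by
  induction X generalizing v with
  | top =>
    cases hv
    exact ⟨_, rfl, ((Eqv.id _).comp (Eqv.cell_top h)).trans (Eqv.id_comp (Eqv.id _))⟩
  | N j =>
    obtain ⟨i, rfl⟩ := hv.exists_numO
    have ht := eqv_num hn j i
    have hg := ht.act g
    -- Naturality at the numeral `⊤ → N_j`, with identity component at `⊤`, turns the image of the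
    -- numeral under `f` into its image under `g`.
    exact ⟨_, val_numO g j i, ((eqv_act_num hn f j i).symm.comp (Eqv.cell h _)).trans
      ((Eqv.cell_natural h ht).symm.trans (((Eqv.cell_top h).comp hg).trans
        ((Eqv.id_comp hg).trans (eqv_act_num hn g j i))))⟩
  | tensor X Y hX hY =>
    obtain ⟨a, b, ha, hb, rfl⟩ := hv
    obtain ⟨w, hw, m⟩ := hX ha
    obtain ⟨x, hx, m'⟩ := hY hb
    have ha' := ha.eqv hn
    have hb' := hb.eqv hn
    exact ⟨_, ⟨w, x, hw, hx, rfl⟩, ((eqv_pr ha' hb').comp (Eqv.cell_tensor h X Y)).trans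
      ((eqv_pr_tens ha' hb' (Eqv.cell h X) (Eqv.cell h Y)).trans (eqv_pr m m'))⟩

/-- The image under `e` of a component is again a component, of `f.comp e ≤ g.comp e`, so
`exists_val_cell` applies to it. -/
theorem cell {f g : Fin n →o Fin n} (h : f ≤ g) (X : Obj n) :
    Computes hn (X.act f) (X.act g) (cell f g X) := by
  intro e v hv
  have hv' := hv.eqv hn
  have hc := Eqv.act_cell (hn := hn) e h X
  rw [Obj.act_act] at hv
  obtain ⟨w, hw, m⟩ := exists_val_cell (hn := hn)
    (show f.comp e ≤ g.comp e from fun i => h (e i)) X hv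
  rw [← Obj.act_act] at hw m
  exact ⟨w, hw, Eqv.cell h X, hv', (hv'.comp hc).trans m⟩

theorem zeroAt (hn : 2 < n) (j : ℕ) (hj : j < n) :
    Computes hn .top (.N ⟨j, hj⟩) (zeroAt j hj) := by
  rintro f _ rfl
  exact ⟨_, val_numO f _ 0, Maps.zeroAt hn f j hj⟩

theorem succAt (hn : 2 < n) (j : ℕ) (hj : j < n) :
    Computes hn (.N ⟨j, hj⟩) (.N ⟨j, hj⟩) (succAt j hj) := by
  intro f v hv
  obtain ⟨i, rfl⟩ := hv.exists_numO
  exact ⟨_, val_numO f _ (i + 1), Maps.succAt hn f j hj i⟩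

/-- Flat recursion has no recursive call, so a case distinction on the numeral suffices; `srr` and
`sdr` need induction. -/
theorem fr {g h : Raw n} (hX : X.IsPowZero) (hY : Y.IsPowZero) (eg : Eqv hn X Y g g)
    (eh : Eqv hn (.tensor (.N ⟨0, by omega⟩) X) Y h h)
    (cg : Computes hn X Y g) (ch : Computes hn (.tensor (.N ⟨0, by omega⟩) X) Y h) :
    Computes hn (.tensor (.N ⟨0, by omega⟩) X) Y (fr g h) := by
  rintro f _ ⟨a, x, ha, hx, rfl⟩
  obtain ⟨i, rfl⟩ := ha.exists_numO
  have hr := Eqv.fr hX hY eg eh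
  cases i with
  | zero =>
    obtain ⟨w, hw, m⟩ := cg f x hx
    exact ⟨w, hw, Maps.rec_zero hr (Eqv.fr_zero hX hY eg eh) m⟩
  | succ i =>
    obtain ⟨w, hw, m⟩ := ch f _ ⟨_, x, val_numO f _ i, hx, rfl⟩
    exact ⟨w, hw, Maps.rec_succ hr (Eqv.fr_succ hX hY eg eh) (hx.eqv hn) m⟩

theorem srr {k : ℕ} (hk : k + 1 < n) {g h : Raw n} (eg : Eqv hn X Y g g) (eh : Eqv hn Y Y h h)
    (hr : Eqv hn (.tensor (.N ⟨k + 1, hk⟩) X) Y (srr k g h) (srr k g h))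
    (cg : Computes hn X Y g) (ch : Computes hn Y Y h) :
    Computes hn (.tensor (.N ⟨k + 1, hk⟩) X) Y (srr k g h) := by
  rintro f _ ⟨a, x, ha, hx, rfl⟩
  obtain ⟨i, rfl⟩ := ha.exists_numO
  clear ha
  induction i with
  | zero =>
    obtain ⟨w, hw, m⟩ := cg f x hx
    exact ⟨w, hw, Maps.rec_zero hr (Eqv.srr_zero hk eg eh hr) m⟩
  | succ i ih =>
    obtain ⟨w, hw, m⟩ := ih
    obtain ⟨y, hy, m'⟩ := ch f w hw
    exact ⟨y, hy, Maps.rec_succ hr (Eqv.srr_succ hk eg eh hr) (hx.eqv hn) (m.comp m')⟩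

theorem sdr {k : ℕ} (hk : k + 1 < n) {g h : Raw n} (eg : Eqv hn X Y g g)
    (eh : Eqv hn (.tensor (.tensor (.N ⟨k + 1, hk⟩) X) Y) Y h h)
    (hr : Eqv hn (.tensor (.N ⟨k + 1, hk⟩) X) Y (sdr k g h) (sdr k g h))
    (cg : Computes hn X Y g)
    (ch : Computes hn (.tensor (.tensor (.N ⟨k + 1, hk⟩) X) Y) Y h) :
    Computes hn (.tensor (.N ⟨k + 1, hk⟩) X) Y (sdr k g h) := by
  rintro f _ ⟨a, x, ha, hx, rfl⟩
  obtain ⟨i, rfl⟩ := ha.exists_numO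
  clear ha
  induction i with
  | zero =>
    obtain ⟨w, hw, m⟩ := cg f x hx
    exact ⟨w, hw, Maps.rec_zero hr (Eqv.sdr_zero hk eg eh hr) m⟩
  | succ i ih =>
    obtain ⟨w, hw, m⟩ := ih
    have hv : Val ((Obj.tensor (.N ⟨k + 1, hk⟩) X).act f)
      (pr (numO ((Obj.N ⟨k + 1, hk⟩).act f) i) x) := ⟨_, x, val_numO f _ i, hx, rfl⟩
    obtain ⟨y, hy, m'⟩ := ch f _ ⟨_, w, hv, hw, rfl⟩
    exact ⟨y, hy, Maps.rec_succ hr (Eqv.sdr_succ hk eg eh hr) (hx.eqv hn)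
      -- The pairing `⟨id, f⟩` is evaluated by duplicating the value, keeping one copy and applying
      -- the induction hypothesis to the other.
      (((maps_diag hn f _ hv).comp ((Maps.id (hv.eqv hn)).tens m)).comp m')⟩

end Computes

/-- Typing and equality are one relation, so the induction runs over derivations of equations.
Claiming computability of the left term only is enough: `symm` passes it across the equation by
`Computes.congr`, and in the uniqueness clauses the left term is already well-formed by a premise.
-/
theorem Eqv.computes {X Y : Obj n} {t u : Raw n} (e : Eqv hn X Y t u) : Computes hn X Y t := by
  induction e with
  | symm e ih => exact ih.congr e
  | trans _ _ ih _ => exact ih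
  | id X => exact .id X
  | comp _ _ h h' => exact h.comp h'
  | id_comp _ h => exact (Computes.id _).comp h
  | comp_id _ h => exact h.comp (.id _)
  | comp_assoc _ _ _ h h' h'' => exact (h.comp h').comp h''
  | tens _ _ h h' => exact h.tens h'
  | tens_id X Y => exact (Computes.id X).tens (.id Y)
  | tens_comp _ _ _ _ h h' h'' h''' => exact (h.tens h'').comp (h'.tens h''')
  | assoc X Y Z => exact .assoc X Y Z
  | assocInv X Y Z => exact .assocInv X Y Z
  | assoc_assocInv X Y Z => exact (Computes.assoc X Y Z).comp (.assocInv X Y Z)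
  | assocInv_assoc X Y Z => exact (Computes.assocInv X Y Z).comp (.assoc X Y Z)
  | assoc_natural _ _ _ h h' h'' => exact ((h.tens h').tens h'').comp (.assoc _ _ _)
  | lam X => exact .lam X
  | lamInv X => exact .lamInv X
  | lam_lamInv X => exact (Computes.lam X).comp (.lamInv X)
  | lamInv_lam X => exact (Computes.lamInv X).comp (.lam X)
  | lam_natural _ h => exact ((Computes.id _).tens h).comp (.lam _)
  | swap X Y => exact .swap X Y
  | swap_swap X Y => exact (Computes.swap X Y).comp (.swap Y X)
  | swap_natural _ _ h h' => exact (h.tens h').comp (.swap _ _)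
  | pentagon W X Y Z =>
    exact ((Computes.assoc W X Y).tens (.id Z)).comp
      ((Computes.assoc W (.tensor X Y) Z).comp ((Computes.id W).tens (.assoc X Y Z)))
  | triangle X Y => exact (Computes.assoc X .top Y).comp ((Computes.id X).tens (.lam Y))
  | hexagon X Y Z =>
    exact (Computes.assoc X Y Z).comp ((Computes.swap X (.tensor Y Z)).comp (.assoc Y Z X))
  | act f _ h => exact h.act f
  | act_id f X => exact (Computes.id X).act f
  | act_comp f _ _ h h' => exact (h.comp h').act f
  | act_tens f _ _ h h' => exact (h.tens h').act f
  | act_assoc f X Y Z => exact (Computes.assoc X Y Z).act f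
  | act_lam f X => exact (Computes.lam X).act f
  | act_swap f X Y => exact (Computes.swap X Y).act f
  | cell h X => exact .cell h X
  | cell_natural h _ ih => exact (Computes.cell h _).comp (ih.act _)
  | cell_top h => exact Computes.cell h .top
  | cell_tensor h X Y => exact Computes.cell h (.tensor X Y)
  | act_one e h => exact h.congr (Eqv.act_one e).symm
  | act_act f g _ h => exact (h.act g).act f
  | cell_refl f X => exact .cell le_rfl X
  | cell_trans h h' X => exact (Computes.cell h X).comp (.cell h' X)
  | act_cell e h X => exact (Computes.cell h X).act e
  | cell_act h e X => exact .cell h (X.act e)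
  | zero => exact Computes.zeroAt hn 0 (by omega)
  | succ => exact Computes.succAt hn 0 (by omega)
  | coT_zero => exact (Computes.id .top).congr Eqv.coT_zero.symm
  | coT_succ => exact (Computes.id .top).congr Eqv.coT_succ.symm
  | fr hX hY eg eh cg ch => exact .fr hX hY eg.left eh.left cg ch
  | fr_zero hX hY eg eh cg ch =>
    exact ((Computes.zeroAt hn 0 (by omega)).tens (.id _)).comp (.fr hX hY eg eh cg ch)
  | fr_succ hX hY eg eh cg ch =>
    exact ((Computes.succAt hn 0 (by omega)).tens (.id _)).comp (.fr hX hY eg eh cg ch)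
  | fr_unique _ _ _ _ _ _ _ _ _ h => exact h
  | srr hk ei ej eij eji eg eh _ _ _ _ cg ch =>
    exact .srr hk eg.left eh.left (.srr hk ei ej eij eji eg.left eh.left) cg ch
  | srr_zero hk _ _ _ _ _ h => exact ((Computes.zeroAt hn _ hk).tens (.id _)).comp h
  | srr_succ hk _ _ _ _ _ h => exact ((Computes.succAt hn _ hk).tens (.id _)).comp h
  | srr_unique _ _ _ _ _ _ _ _ _ _ h => exact h
  | sdr hk ei ej eij eji eg eh _ _ _ _ cg ch =>
    exact .sdr hk eg.left eh.left (.sdr hk ei ej eij eji eg.left eh.left) cg ch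
  | sdr_zero hk _ _ _ _ _ h => exact ((Computes.zeroAt hn _ hk).tens (.id _)).comp h
  | sdr_succ hk _ _ _ _ _ h => exact ((Computes.succAt hn _ hk).tens (.id _)).comp h
  | sdr_unique _ _ _ _ _ _ _ _ _ _ h => exact h

/-! ### Global sections of levels are numerals -/

theorem Eqv.exists_num {k : Fin n} {t : Raw n} (h : Eqv hn .top (.N k) t t) :
    ∃ m, Eqv hn .top (.N k) t (num k m) := by
  -- The source `⊤` has the single value `id ⊤`, and the identity endofunctor returns `t` itself.
  obtain ⟨w, hw, m⟩ := h.computes OrderHom.id (Raw.id .top) rfl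
  have e := m.eqv
  rw [Obj.act_id] at hw e
  obtain ⟨i, rfl⟩ := hw
  have h' := Eqv.act_one h
  exact ⟨i, h'.symm.trans ((Eqv.id_comp h'.left).symm.trans e)⟩

theorem std_eq_mk (k : Fin n) (m : ℕ) : std hn k m = Hom.mk (num k m) (eqv_num hn k m) := by
  induction m with
  | zero => rfl
  | succ m ih =>
    rw [std, ih]
    rfl

theorem std_eq_zero_comp_succPow (k : Fin n) (m : ℕ) :
    std hn k m = zero hn k ≫ succPow hn k m := by
  induction m with
  | zero => exact (Category.comp_id (zero hn k)).symm
  | succ m ih =>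
    rw [std, ih]
    exact Category.assoc (zero hn k) (succPow hn k m) (succ hn k)

theorem exists_eq_std (k : Fin n) (f : 𝟙_ (FR n hn) ⟶ N hn k) : ∃ m, f = std hn k m := by
  induction f using Hom.ind with | _ t ht
  obtain ⟨m, hm⟩ := ht.exists_num
  exact ⟨m, (Hom.sound hm ht (eqv_num hn k m)).trans (std_eq_mk k m).symm⟩

end FRn

theorem proposition24 (n : ℕ) (hn : 2 < n) (k : Fin n) :
    (Set.univ : Set ((FRn.Γ hn).obj (FRn.N hn k))) = Set.range (FRn.std hn k) ∧
      ∀ f : 𝟙_ (FRn.FR n hn) ⟶ FRn.N hn k, ∃ m : ℕ, f = FRn.zero hn k ≫ FRn.succPow hn k m := by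
  refine ⟨(Set.eq_univ_of_forall fun f => ?_).symm, fun f => ?_⟩
  · obtain ⟨m, hm⟩ := FRn.exists_eq_std k f
    exact ⟨m, hm.symm⟩
  · obtain ⟨m, hm⟩ := FRn.exists_eq_std k f
    exact ⟨m, hm.trans (FRn.std_eq_zero_comp_succPow k m)⟩
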